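/- **Setting.** Let $\Sigma=\mathbb{N}_0^{\mathbb{Z}}$ with the product $\sigma$-algebra and the pointwise order $\preccurlyeq$, and write $\eta(I)=\sum_{x\in I}\eta(x)$ for finite $I\subset\mathbb{Z}$. Time is discrete (a continuous-time environment is observed at integer times). An *environment* consists of a non-empty bounded open interval $J\subseteq[0,\infty)$, probability measures $(\mu_\rho)_{\rho\in J}$ on $\Sigma$, and, depending measurably on $\eta_0\in\Sigma$, laws $\mathbf{P}^{\eta_0}$ of processes $(\eta_t)_{t\ge 0}$ in $\Sigma$ started at $\eta_0$. Put $\mathbf{P}^\rho=\int\mu_\rho(d\eta_0)\,\mathbf{P}^{\eta_0}$. A coupling of two laws is a probability measure on the product space with these marginals, and $\le_{\rm st.}$ means that there is a coupling that is almost surely ordered. Assume: * (P.1) Under $\mathbf{P}^{\eta_0}$, for all $s\ge0$, $x\in\mathbb{Z}$, conditionally on $(\eta_u)_{u\le s}$, the process $(\eta_{s+t}(x+\cdot))_{t\ge0}$ has law $\mathbf{P}^{\eta_s(x+\cdot)}$. * (P.2) For all $\rho\in J$ and $s\ge 0$, $(\eta_{t+s})_{t\ge0}$ has the same law as $(\eta_t)_{t\ge0}$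 under $\mathbf{P}^\rho$. * (P.3) $\mathbf{P}^{\eta_0'}\le_{\rm st.}\mathbf{P}^{\eta_0}$ whenever $\eta_0'\preccurlyeq\eta_0$, and $\mu_{\rho'}\le_{\rm st.}\mu_\rho$ whenever $\rho'\le\rho$ in $J$. * (P.4) There is $c>0$ such that for all $\rho\in J$, $\varepsilon\in(0,1)$, $\ell\ge1$ and every interval $I\subset\mathbb{Z}$ of $\ell$ integers, $\mathbf{P}^\rho(|\eta_0(I)-\rho\ell|\ge\varepsilon\ell)\le 2e^{-c\varepsilon^2\ell}$. Assume also that there is $\nu>0$ such that: * (C.2.1) For all integers $t,H\ge0$, $k\ge1$ and all $\eta_0,\eta_0'$ with $\eta_0\succcurlyeq\eta'_0$ on $[-H,H]$, there is a coupling $\mathbb{Q}$ of $\eta\sim\mathbf{P}^{\eta_0}$ and $\eta'\sim\mathbf{P}^{\eta_0'}$ such that, with probability at least $1-20e^{-k\nu t/4}$, $\eta_s\succcurlyeq\eta_s'$ on $[-H+2\nu kt,H-2\nu kt]$ for all $s\in[0,t]$. * (C.2.2) There are $C,C'>0$ such that for all $\rho\in J$, $\varepsilon\in(0,1)$ with $\rho+\varepsilon\in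 J$, and all integers $H,t\ge1$ with $H>4\nu t$, $\nu^8t>1$ and $\nu t^{1/4}>C\varepsilon^{-2}(1+|\log^3(\nu t)|)$: setting $\ell=\lfloor t^{1/4}\rfloor$, if $\eta_0(I)\ge(\rho+\frac{3\varepsilon}{4})|I|$ and $\eta_0'(I)\le(\rho+\frac{\varepsilon}{4})|I|$ for every interval $I\subset[-H,H]$ with $\lfloor\ell/2\rfloor\le|I|\le\ell$, then there is a coupling of $\eta\sim\mathbf{P}^{\eta_0}$ and $\eta'\sim\mathbf{P}^{\eta_0'}$ such that $\eta_t\succcurlyeq\eta'_t$ on $[-H+4\nu t,H-4\nu t]$ with probability at least $1-C'tH\exp(-(C'(1+\nu^{-1}))^{-1}\varepsilon^2t^{1/4})$. **Walks.** For $L\ge1$, under $\mathbf{P}^{\rho,L}$ the environment is resampled from $\mu_\rho$ at every time in $L\mathbb{N}_0$, independently of the past, and in between evolves according to the original dynamics. Let $0\le p_\circ<p_\bullet\le1$. The walk on $\eta$ has $X_0=0$ and $X_{n+1}=X_n\pm1$, where, independently of everything else, the step is $+1$ with probability $p_\circ$ if $\eta_n(X_n)=0$ and $p_\bullet$ if $\eta_n(X_n)\ge1$.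 Let $\mathbb{P}^{\rho,L}$ be the law of $X$ when $\eta\sim\mathbf{P}^{\rho,L}$, and $v(\rho,L)=\mathbb{E}^{\rho,L}[X_L/L]$. **Proposition 3.1.** For every such environment there is an integer $L_0\ge1$ such that, for all $0\le p_\circ<p_\bullet\le 1$, all integers $L>L_0$ and $n\ge1$, all real $f(L)\in[(\log L)^{90},L^{1/10}]$, all $\rho\in J$ with $\rho>f(L)^{-1/40}$ and all $\varepsilon\ge f(L)^{-1/40}$ with $\rho+\varepsilon\in J$, the following holds. There is a coupling $\mathbb{Q}_{n,L}$ of $(X^{(1)}_s)_{0\le s\le n}$ and $(X^{(2)}_s)_{0\le s\le n}$, where $X^{(1)}\sim\mathbb{P}^{\rho,n}$ and $X^{(2)}\sim\mathbb{P}^{\rho+\varepsilon,L}$, such that $$\mathbb{Q}_{n,L}\Big(\min_{0\le s\le n}\big(X^{(2)}_s-X^{(1)}_s\big)<-\Big\lceil\frac nL-1\Big\rceil f(L)\Big)\le\Big(\Big\lceil\frac nL\Big\rceil-1\Big)^2e^{-f(L)^{1/40}},$$ and, if $n>L$, the same holds with $\le$ in place of $<$ inside the probability. Moreover $$v(\rho,n)\le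 v(\rho+\varepsilon,L)+2\,\frac{n-L\lfloor n/L\rfloor}{n}+\Big\lceil\frac nL-1\Big\rceil\frac{f(L)}{n}+2\Big(\Big\lceil\frac nL\Big\rceil-1\Big)^2e^{-f(L)^{1/40}}.$$ The same holds with $X^{(1)}\sim\mathbb{P}^{\rho,L}$ and $X^{(2)}\sim\mathbb{P}^{\rho+\varepsilon,n}$; that is, there is such a coupling with the same probability bounds, and $v(\rho,L)\le v(\rho+\varepsilon,n)$ plus the same three error terms. -/

import Mathlib

open MeasureTheory ProbabilityTheory

noncomputable section

/-- Particle configurations on `ℤ`. -/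
abbrev Config := ℤ → ℕ

/-- Space-time environments `(η_t)_{t ≥ 0}`. Both spaces carry the product `σ`-algebra and the
pointwise order. -/
abbrev EnvPath := ℕ → Config

/-- The number of particles in the interval `[a, a + m - 1]` (of length `m`). -/
def particles (η : Config) (a : ℤ) (m : ℕ) : ℕ := ∑ i ∈ Finset.range m, η (a + i)

/-- Space translation of a configuration: `x`-translate is `η (x + ·)`. -/
def Config.translate (x : ℤ) (η : Config) : Config := fun y => η (x + y)

/-- The space-time shift `t ↦ η_{s+t}(x + ·)`. -/
def EnvPath.shift (s : ℕ) (x : ℤ) (η : EnvPath) : EnvPath := fun t => (η (s + t)).translate x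

/-- `Q` is a coupling of `μ` and `ν`. -/
def IsCoupling {α β : Type*} [MeasurableSpace α] [MeasurableSpace β]
    (Q : Measure (α × β)) (μ : Measure α) (ν : Measure β) : Prop :=
  Q.map Prod.fst = μ ∧ Q.map Prod.snd = ν

/-- Stochastic domination `μ ≤_st ν`: there is a coupling that is almost surely ordered. -/
def StochLE {α : Type*} [MeasurableSpace α] [LE α] (μ ν : Measure α) : Prop :=
  ∃ Q : Measure (α × α), IsCoupling Q μ ν ∧ ∀ᵐ w ∂Q, w.1 ≤ w.2

/-- `η` covers `η'` on the set of integers lying in the real interval `[-r, r]`. -/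
def CoversOn (η η' : Config) (r : ℝ) : Prop :=
  ∀ x : ℤ, -r ≤ (x : ℝ) → (x : ℝ) ≤ r → η' x ≤ η x

/-- The data of an environment: an open bounded interval `J = (lo, hi) ⊆ [0, ∞)` of densities,
initial laws `μ ρ` (only those with `ρ ∈ J` are meaningful), and the law `P η₀` of the process
started at `η₀`, which depends measurably on `η₀`. -/
structure Environment where
  lo : ℝ
  hi : ℝ
  lo_nonneg : 0 ≤ lo
  lo_lt_hi : lo < hi
  μ : ℝ → Measure Config
  isProbabilityMeasure_μ : ∀ ρ, IsProbabilityMeasure (μ ρ)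
  P : Kernel Config EnvPath
  isMarkovKernel_P : IsMarkovKernel P
  start : ∀ η₀, ∀ᵐ η ∂(P η₀), η 0 = η₀

namespace Environment

instance (E : Environment) (ρ : ℝ) : IsProbabilityMeasure (E.μ ρ) := E.isProbabilityMeasure_μ ρ

instance (E : Environment) : IsMarkovKernel E.P := E.isMarkovKernel_P

/-- The interval of densities. -/
def J (E : Environment) : Set ℝ := Set.Ioo E.lo E.hi

/-- The law `∫ μ_ρ(dη₀) P^{η₀}` of the environment started from `μ_ρ`. -/
def annealed (E : Environment) (ρ : ℝ) : Measure EnvPath := (E.μ ρ).bind E.P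

instance (E : Environment) (ρ : ℝ) : IsProbabilityMeasure (E.annealed ρ) := by
  unfold annealed; infer_instance

/-- Markov property and invariance: under `P^{η₀}`, conditionally on `(η_u)_{u ≤ s}`, the process
`(η_{s+t}(x + ·))_t` has law `P^{η_s(x + ·)}`. -/
def MarkovInvariant (E : Environment) : Prop :=
  ∀ (η₀ : Config) (s : ℕ) (x : ℤ) (A : Set (Set.Iic s → Config)) (B : Set EnvPath),
    MeasurableSet A → MeasurableSet B →
    E.P η₀ {η | (fun u : Set.Iic s => η u) ∈ A ∧ η.shift s x ∈ B} =
      ∫⁻ η in {η : EnvPath | (fun u : Set.Iic s => η u) ∈ A},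
        E.P ((η s).translate x) B ∂(E.P η₀)

/-- Stationarity of `μ_ρ`. -/
def Stationary (E : Environment) : Prop :=
  ∀ ρ ∈ E.J, ∀ s : ℕ, (E.annealed ρ).map (fun η t => η (t + s)) = E.annealed ρ

/-- Monotonicity, quenched and annealed. -/
def Monotonicity (E : Environment) : Prop :=
  (∀ η₀' η₀ : Config, η₀' ≤ η₀ → StochLE (E.P η₀') (E.P η₀)) ∧
  (∀ ρ' ∈ E.J, ∀ ρ ∈ E.J, ρ' ≤ ρ → StochLE (E.μ ρ') (E.μ ρ))

/-- Density at stationarity, on all intervals `[a, a + l - 1]` of length `l`. -/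
def DensityAtStationarity (E : Environment) : Prop :=
  ∃ c : ℝ, 0 < c ∧ ∀ ρ ∈ E.J, ∀ ε : ℝ, 0 < ε → ε < 1 → ∀ l : ℕ, 1 ≤ l → ∀ a : ℤ,
    (E.annealed ρ).real {η | ε * l ≤ |(particles (η 0) a l : ℝ) - ρ * l|} ≤
      2 * Real.exp (-(c * ε ^ 2 * l))

/-- No particle drifting in from the side (`ν` is the activity rate). -/
def NoDriftIn (E : Environment) (ν : ℝ) : Prop :=
  ∀ (t H k : ℕ), 1 ≤ k → ∀ η₀ η₀' : Config, CoversOn η₀ η₀' H →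
    ∃ Q : Measure (EnvPath × EnvPath), IsCoupling Q (E.P η₀) (E.P η₀') ∧
      1 - 20 * Real.exp (-(k * ν * t / 4)) ≤
        Q.real {w | ∀ s ≤ t, CoversOn (w.1 s) (w.2 s) (H - 2 * ν * k * t)}

/-- Covering `η'` by `η` (`ν` is the activity rate). -/
def Covering (E : Environment) (ν : ℝ) : Prop :=
  ∃ C C' : ℝ, 0 < C ∧ 0 < C' ∧
    ∀ ρ ∈ E.J, ∀ ε : ℝ, 0 < ε → ε < 1 → ρ + ε ∈ E.J →
    ∀ H t : ℕ, 1 ≤ H → 1 ≤ t → 4 * ν * t < H → 1 < ν ^ 8 * t →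
      C * (ε ^ 2)⁻¹ * (1 + |Real.log (ν * t) ^ 3|) < ν * (t : ℝ) ^ (1 / 4 : ℝ) →
    ∀ l : ℕ, l = ⌊(t : ℝ) ^ (1 / 4 : ℝ)⌋₊ →
    ∀ η₀ η₀' : Config,
      (∀ (a : ℤ) (m : ℕ), l / 2 ≤ m → m ≤ l → -(H : ℤ) ≤ a → a + m - 1 ≤ H →
        (ρ + 3 * ε / 4) * m ≤ particles η₀ a m ∧
        (particles η₀' a m : ℝ) ≤ (ρ + ε / 4) * m) →
    ∃ Q : Measure (EnvPath × EnvPath), IsCoupling Q (E.P η₀) (E.P η₀') ∧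
      1 - C' * t * H * Real.exp (-((C' * (1 + ν⁻¹))⁻¹ * ε ^ 2 * (t : ℝ) ^ (1 / 4 : ℝ))) ≤
        Q.real {w | CoversOn (w.1 t) (w.2 t) (H - 4 * ν * t)}

/-- Concatenation of blocks of length `L`: on `[kL, (k+1)L)`, follow the `k`-th path. -/
def concat (L : ℕ) (ω : ℕ → EnvPath) : EnvPath := fun t => ω (t / L) (t % L)

/-- The finite-range environment `P^{ρ,L}` (`L ≥ 1`): the environment is resampled from `μ_ρ` at
each multiple of `L`, independently of the past, and evolves as the original one in between. That
is, it is the concatenation of the first `L` time units of i.i.d. copies of the environment started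
from `μ_ρ`. -/
def finiteRange (E : Environment) (ρ : ℝ) (L : ℕ) : Measure EnvPath :=
  (Measure.infinitePi (fun _ : ℕ => E.annealed ρ)).map (concat L)

end Environment

/-- The walk in the environment `η`, started at `0` and driven by `u`; `p₀`, `p₁` are the
probabilities to jump to the right from an empty, resp. occupied, site. -/
def walk (p₀ p₁ : ℝ) (η : EnvPath) (u : ℕ → unitInterval) : ℕ → ℤ
  | 0 => 0
  | n + 1 => walk p₀ p₁ η u n +
      2 * (if (u n : ℝ) ≤ (p₀ - p₁) * (if η n (walk p₀ p₁ η u n) = 0 then 1 else 0) + p₁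
        then 1 else 0) - 1

/-- The annealed law of the walk in the finite-range environment: `η` has law `P^{ρ,L}` and,
independently, the driving variables are i.i.d. uniform on `[0,1]`. -/
def walkLaw (E : Environment) (p₀ p₁ ρ : ℝ) (L : ℕ) : Measure (ℕ → ℤ) :=
  ((E.finiteRange ρ L).prod
    (Measure.infinitePi (fun _ : ℕ => (volume : Measure unitInterval)))).map
      (fun w => walk p₀ p₁ w.1 w.2)

/-- The speed `v(ρ, L) = E[X_L / L]` of the walk in the finite-range environment. -/
def speed (E : Environment) (p₀ p₁ ρ : ℝ) (L : ℕ) : ℝ :=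
  ∫ X, (X L : ℝ) / L ∂(walkLaw E p₀ p₁ ρ L)

/-- The trajectory up to time `n`. -/
def upTo (n : ℕ) (X : ℕ → ℤ) : Fin (n + 1) → ℤ := fun s => X s

/-! Measurability facts: the push-forwards above are genuine probability measures. -/

theorem measurable_concat (L : ℕ) : Measurable (Environment.concat L) := by
  unfold Environment.concat
  fun_prop

theorem measurable_walk (p₀ p₁ : ℝ) :
    Measurable (fun w : EnvPath × (ℕ → unitInterval) => walk p₀ p₁ w.1 w.2) := by
  refine measurable_pi_lambda _ fun n => ?_
  induction n with
  | zero => simp only [walk]; exact measurable_const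
  | succ n ih =>
    simp only [walk]
    have h1 : Measurable (fun w : EnvPath × (ℕ → unitInterval) =>
        w.1 n (walk p₀ p₁ w.1 w.2 n)) := by
      have h : Measurable (fun q : ℤ × (EnvPath × (ℕ → unitInterval)) => q.2.1 n q.1) :=
        measurable_from_prod_countable_right fun x =>
          (measurable_pi_apply x).comp ((measurable_pi_apply n).comp measurable_fst)
      exact h.comp (ih.prodMk measurable_id)
    have h2 : Measurable (fun w : EnvPath × (ℕ → unitInterval) =>
        if w.1 n (walk p₀ p₁ w.1 w.2 n) = 0 then (1 : ℝ) else 0) :=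
      Measurable.ite (h1 (measurableSet_singleton 0)) measurable_const measurable_const
    refine Measurable.sub_const (ih.add (Measurable.const_mul (Measurable.ite ?_
      measurable_const measurable_const) 2)) 1
    refine measurableSet_le ?_ ((h2.const_mul _).add_const _)
    fun_prop

instance (E : Environment) (ρ : ℝ) (L : ℕ) : IsProbabilityMeasure (E.finiteRange ρ L) :=
  Measure.isProbabilityMeasure_map (measurable_concat L).aemeasurable

instance (E : Environment) (p₀ p₁ ρ : ℝ) (L : ℕ) :
    IsProbabilityMeasure (walkLaw E p₀ p₁ ρ L) :=
  Measure.isProbabilityMeasure_map (measurable_walk p₀ p₁).aemeasurable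

end

/-!
Over a block of length `L`, let the first environment be restarted from a configuration that is
sparse on all windows of a certain scale, and the second one from a denser configuration. After a
time `t` with `2 * t < f`, the second environment covers the first one shifted by `2 * t`, and by
absence of drift it keeps doing so until the end of the block. Before time `t` the walks drift apart
by at most `2 * t`; afterwards the second walk cannot be overtaken by the first one shifted by
`-2 * t`, since both make steps `±1` and the parity of their difference is fixed. By stationarity
both environments have their invariant laws at the start of a block, whether they are resampled
there or not, so blocks can be glued and each of them loses at most `2 * t`.

Gluing is carried out with the dual form of couplings, which is stable under composition of kernels
without any measurable selection. Strassen's theorem is only needed at the end, for walks with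
finitely many values. The comparison of speeds is obtained by adding the expected increments over
the blocks.
-/

noncomputable section

open scoped ENNReal

/-! ### Couplings in dual form -/

/-- Dual form of the existence of a coupling of `μ` and `ν` under which the relation `R` fails with
probability at most `δ`. -/
def ApproxLift {α β : Type*} [MeasurableSpace α] [MeasurableSpace β] (R : α → β → Prop)
    (μ : Measure α) (ν : Measure β) (δ : ℝ≥0∞) : Prop :=
  ∀ (f : α → ℝ≥0∞) (g : β → ℝ≥0∞), Measurable f → Measurable g → (∀ a, f a ≤ 1) →
    (∀ a b, R a b → f a ≤ g b) → ∫⁻ a, f a ∂μ ≤ ∫⁻ b, g b ∂ν + δ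

namespace ApproxLift

variable {α β γ γ' : Type*} [MeasurableSpace α] [MeasurableSpace β] [MeasurableSpace γ]
  [MeasurableSpace γ'] {R R' : α → β → Prop} {μ : Measure α} {ν : Measure β} {δ δ' : ℝ≥0∞}

theorem mono (h : ApproxLift R μ ν δ) (hR : ∀ a b, R a b → R' a b) (hδ : δ ≤ δ') :
    ApproxLift R' μ ν δ' := fun f g hf hg hf1 hfg =>
  (h f g hf hg hf1 fun a b hab => hfg a b (hR a b hab)).trans (by gcongr)

theorem of_true [IsProbabilityMeasure μ] [IsProbabilityMeasure ν] :
    ApproxLift (fun _ _ => True) μ ν 0 := by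
  intro f g _ _ _ hfg
  calc ∫⁻ a, f a ∂μ ≤ ⨅ b, g b := by
        simpa using lintegral_mono (μ := μ) fun a => le_iInf fun b => hfg a b trivial
    _ ≤ ∫⁻ b, g b ∂ν + 0 := by
        simpa using lintegral_mono (μ := ν) fun b => iInf_le g b

theorem of_isCoupling {Q : Measure (α × β)} (hQ : IsCoupling Q μ ν)
    (hR : Q {w | ¬ R w.1 w.2} ≤ δ) : ApproxLift R μ ν δ := by
  intro f g hf hg hf1 hfg
  set B := toMeasurable Q {w | ¬ R w.1 w.2} with hB
  have hle : ∀ w : α × β, f w.1 ≤ g w.2 + B.indicator 1 w := by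
    intro w
    by_cases hw : R w.1 w.2
    · exact (hfg _ _ hw).trans le_self_add
    · have : w ∈ B := subset_toMeasurable _ _ hw
      simpa [this] using (hf1 w.1).trans le_add_self
  calc ∫⁻ a, f a ∂μ = ∫⁻ w, f w.1 ∂Q := by rw [← hQ.1, lintegral_map hf measurable_fst]
    _ ≤ ∫⁻ w, (g w.2 + B.indicator 1 w) ∂Q := lintegral_mono hle
    _ = ∫⁻ b, g b ∂ν + Q B := by
        rw [lintegral_add_left (by fun_prop : Measurable fun w : α × β => g w.2),
          lintegral_indicator_one (measurableSet_toMeasurable _ _), ← hQ.2,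
          lintegral_map hg measurable_snd]
    _ ≤ ∫⁻ b, g b ∂ν + δ := by rw [hB, measure_toMeasurable]; gcongr

theorem of_isCoupling_real {Q : Measure (α × β)} [IsProbabilityMeasure Q] {p : ℝ}
    (hQ : IsCoupling Q μ ν) (hR : MeasurableSet {w : α × β | R w.1 w.2})
    (hp : 1 - p ≤ Q.real {w | R w.1 w.2}) : ApproxLift R μ ν (ENNReal.ofReal p) := by
  refine of_isCoupling hQ ?_
  rw [← ofReal_measureReal]
  refine ENNReal.ofReal_le_ofReal ?_
  have := probReal_compl_eq_one_sub (μ := Q) hR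
  rw [Set.compl_ofPred] at this
  linarith

theorem of_stochLE [LE α] {μ ν : Measure α} (h : StochLE μ ν) :
    ApproxLift (· ≤ ·) μ ν 0 := by
  obtain ⟨Q, hQ, hle⟩ := h
  exact of_isCoupling hQ (by simpa [ae_iff] using hle)

theorem map {R' : γ → γ' → Prop} (h : ApproxLift R μ ν δ) {φ : α → γ} {ψ : β → γ'}
    (hφ : Measurable φ) (hψ : Measurable ψ) (hR : ∀ a b, R a b → R' (φ a) (ψ b)) :
    ApproxLift R' (μ.map φ) (ν.map ψ) δ := by
  intro f g hf hg hf1 hfg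
  rw [lintegral_map hf hφ, lintegral_map hg hψ]
  exact h _ _ (hf.comp hφ) (hg.comp hψ) (fun _ => hf1 _) fun a b hab => hfg _ _ (hR a b hab)

theorem compProd [SFinite μ] [IsProbabilityMeasure ν] {κ : Kernel α γ} {κ' : Kernel β γ'}
    [IsMarkovKernel κ] [IsMarkovKernel κ'] {S : α × γ → β × γ' → Prop} (h : ApproxLift R μ ν δ)
    (hκ : ∀ a b, R a b → ApproxLift (fun c c' => S (a, c) (b, c')) (κ a) (κ' b) δ') :
    ApproxLift S (μ ⊗ₘ κ) (ν ⊗ₘ κ') (δ + δ') := by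
  intro f g hf hg hf1 hfg
  rw [Measure.lintegral_compProd hf, Measure.lintegral_compProd hg]
  have key := h (fun a => ∫⁻ c, f (a, c) ∂κ a) (fun b => ∫⁻ c, g (b, c) ∂κ' b + δ')
    hf.lintegral_kernel_prod_right' (hg.lintegral_kernel_prod_right'.add_const _)
    (fun a => by simpa using lintegral_mono (μ := κ a) fun c => hf1 (a, c))
    (fun a b hab => hκ a b hab _ _ (hf.comp measurable_prodMk_left)
      (hg.comp measurable_prodMk_left) (fun _ => hf1 _) fun c c' hc => hfg _ _ hc)
  rw [lintegral_add_right _ measurable_const, lintegral_const, measure_univ, mul_one] at key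
  rwa [add_comm δ, ← add_assoc]

theorem restrict (h : ApproxLift R μ ν δ) {S : Set α} {T : Set β} (hS : MeasurableSet S)
    (hT : MeasurableSet T) :
    ApproxLift (fun a b => R a b ∧ a ∈ S ∧ b ∈ T) μ ν (δ + (μ Sᶜ + ν Tᶜ)) := by
  intro f g hf hg hf1 hfg
  have hle : ∀ a, f a ≤ S.indicator f a + Sᶜ.indicator 1 a := by
    intro a
    by_cases ha : a ∈ S <;> simp [ha, hf1 a]
  have key := h (S.indicator f) (fun b => g b + Tᶜ.indicator 1 b) (hf.indicator hS)
    (hg.add (measurable_one.indicator hT.compl))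
    (fun a => Set.indicator_apply_le' (fun _ => hf1 a) (by simp)) ?_
  · calc ∫⁻ a, f a ∂μ ≤ ∫⁻ a, S.indicator f a ∂μ + μ Sᶜ := by
          refine (lintegral_mono hle).trans_eq ?_
          rw [lintegral_add_left (hf.indicator hS), lintegral_indicator_one hS.compl]
      _ ≤ ∫⁻ b, g b ∂ν + ν Tᶜ + δ + μ Sᶜ := by
          rw [lintegral_add_left hg, lintegral_indicator_one hT.compl] at key
          gcongr
      _ = _ := by ring
  · intro a b hab
    by_cases ha : a ∈ S
    · by_cases hb : b ∈ T
      · simpa [ha, hb] using hfg a b ⟨hab, ha, hb⟩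
      · simpa [ha, hb] using (hf1 a).trans le_add_self
    · simp [ha]

theorem lintegral_le (h : ApproxLift R μ ν δ) {f : α → ℝ≥0∞} {g : β → ℝ≥0∞} (hf : Measurable f)
    (hg : Measurable g) {K : ℝ≥0∞} (hK : K ≠ ∞) (hfK : ∀ a, f a ≤ K)
    (hfg : ∀ a b, R a b → f a ≤ g b) : ∫⁻ a, f a ∂μ ≤ ∫⁻ b, g b ∂ν + K * δ := by
  rcases eq_or_ne K 0 with rfl | hK0
  · simp [show f = 0 from funext fun a => le_zero_iff.1 (hfK a)]
  have key := h (fun a => K⁻¹ * f a) (fun b => K⁻¹ * g b) (hf.const_mul _) (hg.const_mul _)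
    (fun a => (mul_le_mul_right (hfK a) _).trans (ENNReal.inv_mul_cancel hK0 hK).le)
    fun a b hab => mul_le_mul_right (hfg a b hab) _
  rw [lintegral_const_mul _ hf, lintegral_const_mul _ hg] at key
  calc ∫⁻ a, f a ∂μ = K * (K⁻¹ * ∫⁻ a, f a ∂μ) := by
        rw [← mul_assoc, ENNReal.mul_inv_cancel hK0 hK, one_mul]
    _ ≤ K * (K⁻¹ * ∫⁻ b, g b ∂ν + δ) := by gcongr
    _ = _ := by rw [mul_add, ← mul_assoc, ENNReal.mul_inv_cancel hK0 hK, one_mul]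

theorem integral_le [IsProbabilityMeasure μ] [IsProbabilityMeasure ν] {d K : ℝ}
    (h : ApproxLift R μ ν (ENNReal.ofReal d)) (hd : 0 ≤ d) {φ : α → ℝ} {ψ : β → ℝ}
    (hφ : Measurable φ) (hψ : Measurable ψ) (hφi : Integrable φ μ) (hψi : Integrable ψ ν)
    (hK : 0 ≤ K) (hR : ∀ a b, R a b → φ a ≤ ψ b) (hφψ : ∀ a b, φ a ≤ ψ b + K) :
    ∫ a, φ a ∂μ ≤ ∫ b, ψ b ∂ν + K * d := by
  obtain ⟨a₀⟩ : Nonempty α := μ.nonempty_of_neZero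
  have : Nonempty β := ν.nonempty_of_neZero
  set m := ⨅ b, ψ b
  have hbdd : BddBelow (Set.range ψ) :=
    ⟨φ a₀ - K, by rintro _ ⟨b, rfl⟩; linarith [hφψ a₀ b]⟩
  have hφm : ∀ a, φ a - m ≤ K := fun a => by
    linarith [le_ciInf fun b => sub_le_iff_le_add.2 (hφψ a b)]
  have hψm : ∀ b, 0 ≤ ψ b - m := fun b => sub_nonneg.2 (ciInf_le hbdd b)
  have key := h.lintegral_le (hφ.sub_const m).ennreal_ofReal (hψ.sub_const m).ennreal_ofReal
    (ENNReal.ofReal_ne_top (r := K)) (fun a => ENNReal.ofReal_le_ofReal (hφm a))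
    fun a b hab => ENNReal.ofReal_le_ofReal (sub_le_sub_right (hR a b hab) m)
  have hφI : Integrable (fun a => φ a - m) μ := hφi.sub (integrable_const m)
  have hψI : Integrable (fun b => ψ b - m) ν := hψi.sub (integrable_const m)
  have hψ0 : 0 ≤ ∫ b, (ψ b - m) ∂ν := integral_nonneg hψm
  rw [← ofReal_integral_eq_lintegral_ofReal hψI (.of_forall hψm), ← ENNReal.ofReal_mul hK,
    ← ENNReal.ofReal_add hψ0 (by positivity)] at key
  have hpos : ∫ a, (φ a - m) ∂μ ≤ (∫⁻ a, ENNReal.ofReal (φ a - m) ∂μ).toReal := by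
    rw [integral_eq_lintegral_pos_part_sub_lintegral_neg_part hφI]
    exact sub_le_self _ ENNReal.toReal_nonneg
  have := hpos.trans (ENNReal.toReal_le_of_le_ofReal (by positivity) key)
  simp only [integral_sub hφi (integrable_const m), integral_sub hψi (integrable_const m),
    integral_const, probReal_univ, one_smul] at this
  linarith

theorem map_prod {Γ : Type*} [MeasurableSpace Γ] {τ : Measure Γ} [IsProbabilityMeasure τ]
    [SFinite μ] [SFinite ν] {R' : γ → γ' → Prop} {F : α × Γ → γ} {G : β × Γ → γ'}
    (hF : Measurable F) (hG : Measurable G)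
    (h : ∀ u, ApproxLift R' (μ.map fun a => F (a, u)) (ν.map fun b => G (b, u)) δ) :
    ApproxLift R' ((μ.prod τ).map F) ((ν.prod τ).map G) δ := by
  intro f g hf hg hf1 hfg
  rw [lintegral_map hf hF, lintegral_map hg hG, lintegral_prod_symm _ (by fun_prop),
    lintegral_prod_symm _ (by fun_prop)]
  calc ∫⁻ u, ∫⁻ a, f (F (a, u)) ∂μ ∂τ ≤ ∫⁻ u, (∫⁻ b, g (G (b, u)) ∂ν + δ) ∂τ := by
        refine lintegral_mono fun u => ?_
        have := h u f g hf hg hf1 hfg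
        rwa [lintegral_map hf (by fun_prop), lintegral_map hg (by fun_prop)] at this
    _ = _ := by rw [lintegral_add_right _ measurable_const]; simp

end ApproxLift

/-! ### Strassen's theorem on finite sets -/

section Strassen

variable {S T : Type*} [Fintype S] [Fintype T]

open Classical in
/-- The marginals of the point mass at `(s, t)`, together with the mass it puts off `R`. -/
def pointMarginals (R : S → T → Prop) (x : S × T) : S ⊕ T ⊕ Unit → ℝ :=
  Sum.elim (Pi.single x.1 1) (Sum.elim (Pi.single x.2 1) fun _ => if R x.1 x.2 then 0 else 1)

open Classical in
/-- The transport plans from `p` to `q` that put mass at most `d` off the relation `R`. -/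
def transportPlans (R : S → T → Prop) (p : S → ℝ) (q : T → ℝ) (d : ℝ) : Set (S × T → ℝ) :=
  {w | (∀ x, 0 ≤ w x) ∧ (∀ s, ∑ t, w (s, t) = p s) ∧ (∀ t, ∑ s, w (s, t) = q t) ∧
    ∑ x with ¬ R x.1 x.2, w x ≤ d}

variable {R : S → T → Prop} {p : S → ℝ} {q : T → ℝ} {d : ℝ}

theorem disjoint_image_stdSimplex_of_transportPlans_eq_empty (h : transportPlans R p q d = ∅) :
    Disjoint (Fintype.linearCombination ℝ (pointMarginals R) '' stdSimplex ℝ (S × T))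
      (Set.univ.pi (Sum.elim (fun s => {p s}) (Sum.elim (fun t => {q t}) fun _ => Set.Iic d))) := by
  classical
  rw [Set.disjoint_left]
  rintro _ ⟨w, hw, rfl⟩ hwD
  refine Set.eq_empty_iff_forall_notMem.1 h w ⟨hw.1, fun s => ?_, fun t => ?_, ?_⟩
  · simpa [Fintype.linearCombination_apply, pointMarginals, Fintype.sum_prod_type_right,
      Pi.single_apply] using hwD (.inl s) trivial
  · simpa [Fintype.linearCombination_apply, pointMarginals, Fintype.sum_prod_type,
      Pi.single_apply] using hwD (.inr (.inl t)) trivial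
  · simpa [Fintype.linearCombination_apply, pointMarginals, Finset.sum_filter]
      using hwD (.inr (.inr ())) trivial

open Classical in
theorem exists_separation_of_transportPlans_eq_empty (h : transportPlans R p q d = ∅) :
    ∃ (a : S → ℝ) (b : T → ℝ) (k u v : ℝ), u < v ∧
      (∀ s t, a s + b t + (if R s t then 0 else k) < u) ∧
      ∀ r ≤ d, v < ∑ s, p s * a s + (∑ t, q t * b t + r * k) := by
  obtain ⟨ℓ, u, v, hpoint, huv, hbox⟩ := geometric_hahn_banach_compact_closed
    ((convex_stdSimplex ℝ _).linear_image _)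
    ((isCompact_stdSimplex ℝ _).image (LinearMap.continuous_of_finiteDimensional _))
    (convex_pi (by
      rintro (s | t | _) -
      exacts [convex_singleton _, convex_singleton _, convex_Iic d]))
    (isClosed_set_pi (by
      rintro (s | t | _) -
      exacts [isClosed_singleton, isClosed_singleton, isClosed_Iic]))
    (disjoint_image_stdSimplex_of_transportPlans_eq_empty h)
  set c : S ⊕ T ⊕ Unit → ℝ := fun i => ℓ fun j => if i = j then 1 else 0
  have hℓ : ∀ x, ℓ x = ∑ s, x (.inl s) * c (.inl s) + (∑ t, x (.inr (.inl t)) * c (.inr (.inl t))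
      + x (.inr (.inr ())) * c (.inr (.inr ()))) := fun x => by
    simpa using LinearMap.pi_apply_eq_sum_univ ℓ.toLinearMap x
  refine ⟨fun s => c (.inl s), fun t => c (.inr (.inl t)), c (.inr (.inr ())), u, v, huv,
    fun s t => ?_, fun r hr => ?_⟩
  · have := hpoint _ ⟨_, single_mem_stdSimplex ℝ (s, t), rfl⟩
    simpa [hℓ, Fintype.linearCombination_apply_single, pointMarginals, Pi.single_apply,
      add_assoc] using this
  · simpa [hℓ] using hbox (Sum.elim p (Sum.elim q fun _ => r))
      (by rintro (s | t | _) -; exacts [rfl, rfl, hr])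

theorem nonempty_transportPlans (hq : ∑ t, q t = 1)
    (h : ∀ (k : ℝ) (F : S → ℝ) (G : T → ℝ), 0 ≤ k → (∀ s t, R s t → F s ≤ G t) →
      (∀ s t, F s ≤ G t + k) → ∑ s, p s * F s ≤ ∑ t, q t * G t + k * d) :
    (transportPlans R p q d).Nonempty := by
  by_contra! hempty
  obtain ⟨a, b, k, u, v, huv, hpoint, hbox⟩ :=
    exists_separation_of_transportPlans_eq_empty hempty
  have hk : k ≤ 0 := by
    by_contra! hk
    set B := ∑ s, p s * a s + ∑ t, q t * b t
    have hr : min d ((v - B) / k) * k ≤ v - B := by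
      rw [← le_div_iff₀ hk]; exact min_le_right _ _
    linarith [hbox (min d ((v - B) / k)) (min_le_left _ _)]
  have hsum := h (-k) a (fun t => u - b t) (by linarith)
    (fun s t hst => by have := hpoint s t; simp only [hst, if_true] at this; linarith)
    (fun s t => by have := hpoint s t; split_ifs at this <;> linarith)
  simp only [mul_sub, Finset.sum_sub_distrib, ← Finset.sum_mul, hq] at hsum
  linarith [hbox d le_rfl]

end Strassen

theorem sum_ofReal_smul_dirac_apply {X : Type*} [Fintype X] [MeasurableSpace X]
    [MeasurableSingletonClass X] (w : X → ℝ) (hw : ∀ x, 0 ≤ w x) (A : Set X)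
    [DecidablePred (· ∈ A)] :
    (∑ x, ENNReal.ofReal (w x) • Measure.dirac x) A = ENNReal.ofReal (∑ x with x ∈ A, w x) := by
  rw [ENNReal.ofReal_sum_of_nonneg fun x _ => hw x, Finset.sum_filter]
  simp [Measure.finsetSum_apply, Set.indicator_apply]

theorem ApproxLift.exists_isCoupling_of_finite {S T : Type*} [Finite S] [Finite T]
    [MeasurableSpace S] [MeasurableSpace T] [MeasurableSingletonClass S]
    [MeasurableSingletonClass T] {μ : Measure S} {ν : Measure T} [IsProbabilityMeasure μ]
    [IsProbabilityMeasure ν] {R : S → T → Prop} {d : ℝ} (hd : 0 ≤ d)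
    (h : ApproxLift R μ ν (ENNReal.ofReal d)) :
    ∃ Q : Measure (S × T), IsCoupling Q μ ν ∧ Q.real {w | ¬ R w.1 w.2} ≤ d := by
  classical
  have := Fintype.ofFinite S
  have := Fintype.ofFinite T
  obtain ⟨w, hw0, hwp, hwq, hwd⟩ := nonempty_transportPlans (p := fun s => μ.real {s})
    (q := fun t => ν.real {t}) (R := R) (d := d) (by simp)
    (fun k F G hk hR hFG => by
      simpa [integral_fintype] using
        h.integral_le hd .of_discrete .of_discrete .of_finite .of_finite hk hR hFG)
  refine ⟨∑ x, ENNReal.ofReal (w x) • Measure.dirac x, ⟨?_, ?_⟩, ?_⟩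
  · refine Measure.ext_of_singleton fun s => ?_
    rw [Measure.map_apply measurable_fst (.of_discrete),
      sum_ofReal_smul_dirac_apply w hw0, ← ofReal_measureReal]
    refine congrArg _ (Eq.trans ?_ (hwp s))
    simp [Finset.sum_filter, Fintype.sum_prod_type_right]
  · refine Measure.ext_of_singleton fun t => ?_
    rw [Measure.map_apply measurable_snd (.of_discrete),
      sum_ofReal_smul_dirac_apply w hw0, ← ofReal_measureReal]
    refine congrArg _ (Eq.trans ?_ (hwq t))
    simp [Finset.sum_filter, Fintype.sum_prod_type]
  · rw [measureReal_def, sum_ofReal_smul_dirac_apply w hw0]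
    exact ENNReal.toReal_le_of_le_ofReal hd (ENNReal.ofReal_le_ofReal (by simpa using hwd))

theorem exists_map_map_val_eq {γ : Type*} [MeasurableSpace γ] [DiscreteMeasurableSpace γ]
    (μ : Measure γ) [IsProbabilityMeasure μ] (A : Finset γ) (hA : μ (A : Set γ)ᶜ = 0) :
    ∃ r : γ → A, (∀ a : A, r a = a) ∧ (μ.map r).map Subtype.val = μ := by
  classical
  obtain ⟨a₀, ha₀⟩ : A.Nonempty := by
    rw [Finset.nonempty_iff_ne_empty]
    rintro rfl
    simp at hA
  let r : γ → A := fun x => if h : x ∈ A then ⟨x, h⟩ else ⟨a₀, ha₀⟩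
  refine ⟨r, fun a => by simp [r], ?_⟩
  rw [Measure.map_map .of_discrete .of_discrete]
  have hr : Subtype.val ∘ r =ᵐ[μ] id := by
    filter_upwards [show (A : Set γ) ∈ ae μ from hA] with x hx
    simp [r, Finset.mem_coe.1 hx]
  rw [Measure.map_congr hr, Measure.map_id]

theorem ApproxLift.exists_isCoupling {α β : Type*} [MeasurableSpace α] [MeasurableSpace β]
    [Countable α] [Countable β] [MeasurableSingletonClass α] [MeasurableSingletonClass β]
    {μ : Measure α} {ν : Measure β} [IsProbabilityMeasure μ] [IsProbabilityMeasure ν]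
    {S : Finset α} {T : Finset β}
    (hS : μ (S : Set α)ᶜ = 0) (hT : ν (T : Set β)ᶜ = 0) {R : α → β → Prop} {d : ℝ} (hd : 0 ≤ d)
    (h : ApproxLift R μ ν (ENNReal.ofReal d)) :
    ∃ Q : Measure (α × β), IsCoupling Q μ ν ∧ Q.real {w | ¬ R w.1 w.2} ≤ d := by
  obtain ⟨r, hrS, hrμ⟩ := exists_map_map_val_eq μ S hS
  obtain ⟨r', hrT, hrν⟩ := exists_map_map_val_eq ν T hT
  have hST := (h.restrict S.measurableSet T.measurableSet).map (φ := r) (ψ := r')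
    .of_discrete .of_discrete (R' := fun s t => R s.1 t.1) (by
      rintro a b ⟨hab, ha, hb⟩
      have h₁ : r a = ⟨a, ha⟩ := hrS ⟨a, ha⟩
      have h₂ : r' b = ⟨b, hb⟩ := hrT ⟨b, hb⟩
      rwa [h₁, h₂])
  rw [hS, hT, add_zero, add_zero] at hST
  have := Measure.isProbabilityMeasure_map (μ := μ) (Measurable.of_discrete (f := r)).aemeasurable
  have := Measure.isProbabilityMeasure_map (μ := ν) (Measurable.of_discrete (f := r')).aemeasurable
  obtain ⟨Q, hQ, hQd⟩ := hST.exists_isCoupling_of_finite hd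
  have hval : Measurable (Prod.map Subtype.val Subtype.val : S × T → α × β) := by fun_prop
  refine ⟨Q.map (Prod.map Subtype.val Subtype.val), ⟨?_, ?_⟩, ?_⟩
  · rw [Measure.map_map measurable_fst hval, ← hrμ, ← hQ.1,
      Measure.map_map (by fun_prop) measurable_fst]
    rfl
  · rw [Measure.map_map measurable_snd hval, ← hrν, ← hQ.2,
      Measure.map_map (by fun_prop) measurable_snd]
    rfl
  · rwa [map_measureReal_apply hval .of_discrete]

/-! ### Restarting the environment -/

theorem Config.translate_zero (η : Config) : η.translate 0 = η := by
  funext y; simp [Config.translate]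

namespace EnvPath

/-- Space translation of a space-time environment. -/
def translate (x : ℤ) (ζ : EnvPath) : EnvPath := fun t => (ζ t).translate x

theorem shift_zero_left (x : ℤ) : EnvPath.shift 0 x = translate x := by
  funext ζ t; simp [EnvPath.shift, translate]

@[fun_prop]
theorem measurable_translate (x : ℤ) : Measurable (translate x) := by
  unfold translate Config.translate; fun_prop

@[fun_prop]
theorem measurable_shift (s : ℕ) (x : ℤ) : Measurable (EnvPath.shift s x) := by
  unfold EnvPath.shift Config.translate; fun_prop

/-- The environment that follows `ζ` before time `m` and is restarted with `ξ` at time `m`. -/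
def glue (m : ℕ) (ζ ξ : EnvPath) : EnvPath := fun s => if s < m then ζ s else ξ (s - m)

theorem glue_of_lt {m s : ℕ} (hs : s < m) (ζ ξ : EnvPath) : glue m ζ ξ s = ζ s := if_pos hs

@[simp]
theorem glue_add (m s : ℕ) (ζ ξ : EnvPath) : glue m ζ ξ (m + s) = ξ s := by simp [glue]

@[simp]
theorem glue_self (m : ℕ) (ζ ξ : EnvPath) : glue m ζ ξ m = ξ 0 := by simp [glue]

@[simp]
theorem glue_zero (ζ ξ : EnvPath) : glue 0 ζ ξ = ξ := by funext s; simp [glue]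

theorem glue_glue (a b : ℕ) (α ζ ξ : EnvPath) :
    glue a α (glue b ζ ξ) = glue (a + b) (glue a α ζ) ξ := by
  funext s
  simp only [glue, Nat.sub_sub]
  split_ifs <;> first | rfl | omega

@[fun_prop]
theorem measurable_glue (m : ℕ) : Measurable fun w : EnvPath × EnvPath => glue m w.1 w.2 := by
  refine measurable_pi_lambda _ fun s => ?_
  unfold glue
  split_ifs <;> fun_prop

end EnvPath

open EnvPath

namespace Environment

variable {E : Environment}

theorem MarkovInvariant.map_translate (h : E.MarkovInvariant) (x : ℤ) (η : Config) :
    (E.P η).map (EnvPath.translate x) = E.P (η.translate x) := by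
  ext B hB
  have hx := h η 0 x Set.univ B .univ hB
  have hstart : ∀ᵐ ζ ∂(E.P η), E.P ((ζ 0).translate x) B = E.P (η.translate x) B := by
    filter_upwards [E.start η] with ζ hζ
    rw [hζ]
  simp only [Set.mem_univ, true_and, Set.ofPred_true, Measure.restrict_univ, shift_zero_left,
    lintegral_congr_ae hstart, lintegral_const, measure_univ, mul_one] at hx
  rw [Measure.map_apply (by fun_prop) hB]
  exact hx

/-- The kernel that restarts the environment from its state at time `m`. -/
def restart (E : Environment) (m : ℕ) : Kernel EnvPath EnvPath :=
  E.P.comap (fun ζ => ζ m) (measurable_pi_apply m)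

@[simp]
theorem restart_apply (m : ℕ) (ζ : EnvPath) : E.restart m ζ = E.P (ζ m) := rfl

instance (m : ℕ) : IsMarkovKernel (E.restart m) := by unfold restart; infer_instance

theorem MarkovInvariant.map_restrict_prod_shift (h : E.MarkovInvariant) (m : ℕ) (η : Config) :
    (E.P η).map (fun ζ => (fun i : Set.Iic m => ζ i, ζ.shift m 0)) =
      (E.P η ⊗ₘ E.restart m).map (Prod.map (fun ζ (i : Set.Iic m) => ζ i) id) := by
  have := Measure.isProbabilityMeasure_map (μ := E.P η)
    (f := fun ζ => (fun i : Set.Iic m => ζ i, ζ.shift m 0)) (by fun_prop)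
  refine Measure.ext_prod fun {s t} hs ht => ?_
  have hpre : Prod.map (fun (ζ : EnvPath) (i : Set.Iic m) => ζ i) id ⁻¹' s ×ˢ t =
    ((fun (ζ : EnvPath) (i : Set.Iic m) => ζ i) ⁻¹' s) ×ˢ t := rfl
  rw [Measure.map_apply (by fun_prop) (hs.prod ht), Measure.map_apply (by fun_prop) (hs.prod ht),
    hpre, Measure.compProd_apply_prod (by measurability) ht]
  have := h η m 0 s t hs ht
  simp only [Config.translate_zero] at this
  exact this

theorem MarkovInvariant.map_glue (h : E.MarkovInvariant) (m : ℕ) (η : Config) :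
    (E.P η ⊗ₘ E.restart m).map (fun w => glue m w.1 w.2) = E.P η := by
  let φ : (Set.Iic m → Config) × EnvPath → EnvPath := fun w s =>
    if hs : s < m then w.1 ⟨s, hs.le⟩ else w.2 (s - m)
  have hφ : Measurable φ := by
    refine measurable_pi_lambda _ fun s => ?_
    simp only [φ]
    split_ifs <;> fun_prop
  have key := congrArg (Measure.map φ) (h.map_restrict_prod_shift m η)
  rw [Measure.map_map hφ (by fun_prop), Measure.map_map hφ (by fun_prop)] at key
  have hid : (φ ∘ fun ζ : EnvPath => (fun i : Set.Iic m => ζ i, ζ.shift m 0)) = id := by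
    funext ζ s
    by_cases hs : s < m
    · simp [φ, hs]
    · simp [φ, hs, EnvPath.shift, Config.translate_zero, Nat.add_sub_cancel' (not_lt.1 hs)]
  rw [hid, Measure.map_id] at key
  exact key.symm

theorem annealed_map_apply_zero (ρ : ℝ) : (E.annealed ρ).map (fun ζ => ζ 0) = E.μ ρ := by
  refine Measure.ext_of_lintegral _ fun f hf => ?_
  rw [lintegral_map hf (by fun_prop), annealed, Measure.lintegral_bind (by fun_prop)
    (f := fun ζ : EnvPath => f (ζ 0)) (hf.comp (measurable_pi_apply 0)).aemeasurable]
  refine lintegral_congr fun η => ?_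
  rw [lintegral_congr_ae (g := fun _ => f η) (by filter_upwards [E.start η] with ζ hζ; rw [hζ])]
  simp

theorem Stationary.annealed_map_apply (h : E.Stationary) {ρ : ℝ} (hρ : ρ ∈ E.J) (s : ℕ) :
    (E.annealed ρ).map (fun ζ => ζ s) = E.μ ρ := by
  have := congrArg (Measure.map fun ζ : EnvPath => ζ 0) (h ρ hρ s)
  rw [Measure.map_map (by fun_prop) (by fun_prop), annealed_map_apply_zero] at this
  simpa [Function.comp_def] using this

theorem MarkovInvariant.annealed_map_glue (h : E.MarkovInvariant) (ρ : ℝ) (m : ℕ) :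
    (E.annealed ρ ⊗ₘ E.restart m).map (fun w => glue m w.1 w.2) = E.annealed ρ := by
  refine Measure.ext_of_lintegral _ fun f hf => ?_
  have hg : Measurable fun w : EnvPath × EnvPath => f (glue m w.1 w.2) := by fun_prop
  rw [lintegral_map hf (by fun_prop), Measure.lintegral_compProd hg, annealed,
    Measure.lintegral_bind (by fun_prop) hg.lintegral_kernel_prod_right'.aemeasurable,
    Measure.lintegral_bind (by fun_prop) hf.aemeasurable]
  refine lintegral_congr fun η => ?_
  rw [← Measure.lintegral_compProd hg, ← lintegral_map hf (by fun_prop), h.map_glue]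

end Environment

/-! ### Walks in ordered environments -/

section Walk

variable (p₀ p₁ : ℝ) (u : ℕ → unitInterval) (ζ ξ : EnvPath)

theorem walk_succ_sub (n : ℕ) :
    walk p₀ p₁ ζ u (n + 1) - walk p₀ p₁ ζ u n = 1 ∨
      walk p₀ p₁ ζ u (n + 1) - walk p₀ p₁ ζ u n = -1 := by
  simp only [walk]
  split_ifs <;> omega

theorem abs_walk_add_sub_le (m n : ℕ) :
    |walk p₀ p₁ ζ u (m + n) - walk p₀ p₁ ζ u m| ≤ n := by
  induction n with
  | zero => simp
  | succ n ih =>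
    have := walk_succ_sub p₀ p₁ u ζ (m + n)
    rw [abs_le] at ih ⊢
    rw [← add_assoc]
    push_cast
    omega

theorem abs_walk_le (n : ℕ) : |walk p₀ p₁ ζ u n| ≤ n := by
  simpa [walk] using abs_walk_add_sub_le p₀ p₁ u ζ 0 n

theorem even_walk_add (n : ℕ) : Even (walk p₀ p₁ ζ u n + n) := by
  induction n with
  | zero => simp [walk]
  | succ n ih =>
    have := walk_succ_sub p₀ p₁ u ζ n
    rw [Int.even_iff] at ih ⊢
    push_cast
    omega

variable {ζ ξ} in
theorem walk_congr {n : ℕ} (h : ∀ s < n, ζ s = ξ s) : walk p₀ p₁ ζ u n = walk p₀ p₁ ξ u n := by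
  induction n with
  | zero => rfl
  | succ n ih => simp only [walk, ih fun s hs => h s (hs.trans n.lt_succ_self), h n n.lt_succ_self]

theorem walk_glue_of_le {m s : ℕ} (hs : s ≤ m) :
    walk p₀ p₁ (glue m ζ ξ) u s = walk p₀ p₁ ζ u s :=
  walk_congr p₀ p₁ u fun _ hr => glue_of_lt (hr.trans_le hs) ζ ξ

theorem walk_glue_add (m n : ℕ) :
    walk p₀ p₁ (glue m ζ ξ) u (m + n) = walk p₀ p₁ ζ u m +
      walk p₀ p₁ (ξ.translate (walk p₀ p₁ ζ u m)) (fun i => u (m + i)) n := by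
  induction n with
  | zero => simp [walk, walk_glue_of_le]
  | succ n ih =>
    rw [← add_assoc, walk, ih, glue_add, walk, add_sub_assoc, add_sub_assoc, add_assoc]
    rfl

end Walk

theorem walk_succ_le_of_le {p₀ p₁ : ℝ} (hp : p₀ ≤ p₁) (u : ℕ → unitInterval) {ζ₁ ζ₂ : EnvPath}
    {D : ℤ} {s : ℕ} (h : walk p₀ p₁ ζ₁ u s - D = walk p₀ p₁ ζ₂ u s)
    (hle : ζ₁ s (walk p₀ p₁ ζ₁ u s) ≤ ζ₂ s (walk p₀ p₁ ζ₂ u s)) :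
    walk p₀ p₁ ζ₁ u (s + 1) - D ≤ walk p₀ p₁ ζ₂ u (s + 1) := by
  simp only [walk]
  split_ifs <;> first | omega | (exfalso; linarith)

theorem walk_sub_le_walk {p₀ p₁ : ℝ} (hp : p₀ ≤ p₁) (u : ℕ → unitInterval) {ζ₁ ζ₂ : EnvPath}
    {D : ℤ} (hD : Even D) {m n : ℕ} (hm : walk p₀ p₁ ζ₁ u m - D ≤ walk p₀ p₁ ζ₂ u m)
    (hcov : ∀ s, m ≤ s → s < n → CoversOn (ζ₂ s) ((ζ₁ s).translate D) n) {s : ℕ}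
    (hms : m ≤ s) (hsn : s ≤ n) : walk p₀ p₁ ζ₁ u s - D ≤ walk p₀ p₁ ζ₂ u s := by
  induction s, hms using Nat.le_induction with
  | base => exact hm
  | succ s hms ih =>
    rcases (ih (by omega)).eq_or_lt with heq | hlt
    · have habs : |(walk p₀ p₁ ζ₂ u s : ℝ)| ≤ n := by
        exact_mod_cast (abs_walk_le p₀ p₁ u ζ₂ s).trans (by omega)
      have := hcov s hms hsn _ (abs_le.1 habs).1 (abs_le.1 habs).2
      refine walk_succ_le_of_le hp u heq ?_
      rwa [Config.translate, ← heq, add_sub_cancel, heq] at this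
    · have h₁ := walk_succ_sub p₀ p₁ u ζ₁ s
      have h₂ := walk_succ_sub p₀ p₁ u ζ₂ s
      have e₁ := even_walk_add p₀ p₁ u ζ₁ s
      have e₂ := even_walk_add p₀ p₁ u ζ₂ s
      rw [Int.even_iff] at hD e₁ e₂
      omega

@[fun_prop]
theorem measurable_walk_left (p₀ p₁ : ℝ) (u : ℕ → unitInterval) (n : ℕ) :
    Measurable fun ζ : EnvPath => walk p₀ p₁ ζ u n :=
  (measurable_pi_apply n).comp
    ((measurable_walk p₀ p₁).comp (measurable_id.prodMk measurable_const))

/-! ### Coupling over one block -/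

theorem CoversOn.mono {η η' : Config} {r s : ℝ} (h : CoversOn η η' r) (hs : s ≤ r) :
    CoversOn η η' s := fun x h₁ h₂ => h x (by linarith) (by linarith)

theorem measurableSet_coversOn (r : ℝ) :
    MeasurableSet {w : Config × Config | CoversOn w.1 w.2 r} := by
  simp only [CoversOn, Set.ofPred_forall]
  measurability

@[fun_prop]
theorem measurable_particles (a : ℤ) (m : ℕ) : Measurable fun η => particles η a m := by
  unfold particles
  fun_prop

theorem particles_translate (x : ℤ) (η : Config) (a : ℤ) (m : ℕ) :
    particles (η.translate x) a m = particles η (x + a) m := by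
  simp only [particles, Config.translate, add_assoc]

/-- The configurations whose particle density is at most `r` on every interval in `[-H, H]` of
length between `⌊l / 2⌋` and `l`. -/
def sparseConfigs (r : ℝ) (l H : ℕ) : Set Config :=
  {η | ∀ (a : ℤ) (m : ℕ), l / 2 ≤ m → m ≤ l → -(H : ℤ) ≤ a → a + m - 1 ≤ H →
    (particles η a m : ℝ) ≤ r * m}

/-- The configurations whose particle density is at least `r` on every interval in `[-H, H]` of
length between `⌊l / 2⌋` and `l`. -/
def denseConfigs (r : ℝ) (l H : ℕ) : Set Config :=
  {η | ∀ (a : ℤ) (m : ℕ), l / 2 ≤ m → m ≤ l → -(H : ℤ) ≤ a → a + m - 1 ≤ H →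
    r * m ≤ (particles η a m : ℝ)}

theorem measurableSet_sparseConfigs (r : ℝ) (l H : ℕ) : MeasurableSet (sparseConfigs r l H) := by
  simp only [sparseConfigs, Set.ofPred_forall]
  measurability

theorem measurableSet_denseConfigs (r : ℝ) (l H : ℕ) : MeasurableSet (denseConfigs r l H) := by
  simp only [denseConfigs, Set.ofPred_forall]
  measurability

theorem translate_mem_sparseConfigs {r : ℝ} {l H H' : ℕ} {η : Config}
    (h : η ∈ sparseConfigs r l H') {x : ℤ} (hx : H + |x| ≤ H') :
    η.translate x ∈ sparseConfigs r l H := by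
  intro a m h₁ h₂ h₃ h₄
  rw [particles_translate]
  obtain ⟨hx₁, hx₂⟩ := abs_le.1 (le_sub_iff_add_le'.2 hx)
  exact h (x + a) m h₁ h₂ (by omega) (by omega)

theorem translate_mem_denseConfigs {r : ℝ} {l H H' : ℕ} {η : Config}
    (h : η ∈ denseConfigs r l H') {x : ℤ} (hx : H + |x| ≤ H') :
    η.translate x ∈ denseConfigs r l H := by
  intro a m h₁ h₂ h₃ h₄
  rw [particles_translate]
  obtain ⟨hx₁, hx₂⟩ := abs_le.1 (le_sub_iff_add_le'.2 hx)
  exact h (x + a) m h₁ h₂ (by omega) (by omega)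

theorem Config.translate_neg_translate (x : ℤ) (η : Config) :
    (η.translate x).translate (-x) = η := by
  funext y
  simp [Config.translate]

theorem EnvPath.translate_zero (ζ : EnvPath) : ζ.translate 0 = ζ :=
  funext fun t => (ζ t).translate_zero

theorem EnvPath.translate_translate_neg (x : ℤ) (ζ : EnvPath) :
    (ζ.translate (-x)).translate x = ζ := by
  funext t y
  simp [EnvPath.translate, Config.translate]

namespace Environment

variable {E : Environment}

theorem MarkovInvariant.approxLift_translate (h : E.MarkovInvariant)
    {R : EnvPath → EnvPath → Prop} {η₁ η₂ : Config} {x₁ x₂ : ℤ} {δ : ℝ≥0∞}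
    (hR : ApproxLift R (E.P (η₁.translate x₁)) (E.P (η₂.translate x₂)) δ) :
    ApproxLift (fun ζ₁ ζ₂ => R (ζ₁.translate x₁) (ζ₂.translate x₂)) (E.P η₁) (E.P η₂) δ := by
  have := hR.map (measurable_translate (-x₁)) (measurable_translate (-x₂))
    (R' := fun ζ₁ ζ₂ => R (ζ₁.translate x₁) (ζ₂.translate x₂)) fun ζ₁ ζ₂ hζ => by
      rwa [translate_translate_neg, translate_translate_neg]
  rwa [h.map_translate, h.map_translate, Config.translate_neg_translate,
    Config.translate_neg_translate] at this

theorem MarkovInvariant.approxLift_of_isCoupling (h : E.MarkovInvariant) {η₁ η₂ : Config} {D : ℤ}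
    {Q : Measure (EnvPath × EnvPath)} (hQ : IsCoupling Q (E.P η₂) (E.P (η₁.translate D)))
    {R : EnvPath → EnvPath → Prop} (hR : MeasurableSet {w : EnvPath × EnvPath | R w.1 w.2}) {p : ℝ}
    (hp : 1 - p ≤ Q.real {w | R w.1 w.2}) :
    ApproxLift (fun ζ₁ ζ₂ => R ζ₂ (ζ₁.translate D)) (E.P η₁) (E.P η₂) (ENNReal.ofReal p) := by
  have hswap : IsCoupling (Q.map Prod.swap) (E.P (η₁.translate D)) (E.P η₂) := by
    refine ⟨?_, ?_⟩ <;> rw [Measure.map_map (by fun_prop) (by fun_prop)]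
    exacts [hQ.2, hQ.1]
  have : IsProbabilityMeasure Q := by
    have : IsProbabilityMeasure (Q.map Prod.fst) := hQ.1 ▸ inferInstance
    exact Measure.isProbabilityMeasure_of_map Prod.fst
  have := Measure.isProbabilityMeasure_map (μ := Q) measurable_swap.aemeasurable
  have hR' : MeasurableSet {w : EnvPath × EnvPath | R w.2 w.1} := measurable_swap hR
  have key := ApproxLift.of_isCoupling_real (R := fun ζ₁ ζ₂ => R ζ₂ ζ₁) hswap hR' (p := p) (by
    rw [map_measureReal_apply measurable_swap hR']
    exact hp)
  rw [← η₂.translate_zero] at key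
  simpa only [EnvPath.translate_zero] using h.approxLift_translate key

theorem NoDriftIn.approxLift {ν : ℝ} (h : E.NoDriftIn ν) (hE : E.MarkovInvariant) {η₁ η₂ : Config}
    {D : ℤ} {M : ℕ} (hcov : CoversOn η₂ (η₁.translate D) M) (t : ℕ) :
    ApproxLift (fun ζ₁ ζ₂ => ∀ s ≤ t, CoversOn (ζ₂ s) ((ζ₁ s).translate D) (M - 2 * ν * t))
      (E.P η₁) (E.P η₂) (ENNReal.ofReal (20 * Real.exp (-(ν * t / 4)))) := by
  obtain ⟨Q, hQ, hle⟩ := h t M 1 le_rfl _ _ hcov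
  simp only [Nat.cast_one, one_mul, mul_one] at hle
  refine hE.approxLift_of_isCoupling hQ
    (R := fun ζ ζ' => ∀ s ≤ t, CoversOn (ζ s) (ζ' s) (M - 2 * ν * t)) ?_ hle
  simp only [Set.ofPred_forall]
  exact .iInter fun s => .iInter fun _ => (measurableSet_coversOn _).preimage
    (f := fun w : EnvPath × EnvPath => (w.1 s, w.2 s)) (by fun_prop)

/-- At time `t` and up to probability `p`, the environments started from a configuration of density
at least `r₂` cover on `[-M, M]` those started from a configuration of density at most `r₁`. -/
def CoversAt (E : Environment) (r₁ r₂ : ℝ) (l H t M : ℕ) (p : ℝ) : Prop :=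
  ∀ η₁ ∈ sparseConfigs r₁ l H, ∀ η₂ ∈ denseConfigs r₂ l H,
    ∃ Q : Measure (EnvPath × EnvPath), IsCoupling Q (E.P η₂) (E.P η₁) ∧
      1 - p ≤ Q.real {w | CoversOn (w.1 t) (w.2 t) M}

theorem CoversAt.approxLift {r₁ r₂ p : ℝ} {l H t M : ℕ} (h : E.CoversAt r₁ r₂ l H t M p)
    (hE : E.MarkovInvariant) {D : ℤ} {η₁ η₂ : Config} (h₁ : η₁.translate D ∈ sparseConfigs r₁ l H)
    (h₂ : η₂ ∈ denseConfigs r₂ l H) :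
    ApproxLift (fun ζ₁ ζ₂ => CoversOn (ζ₂ t) ((ζ₁ t).translate D) M) (E.P η₁) (E.P η₂)
      (ENNReal.ofReal p) := by
  obtain ⟨Q, hQ, hle⟩ := h _ h₁ _ h₂
  exact hE.approxLift_of_isCoupling hQ (R := fun ζ ζ' => CoversOn (ζ t) (ζ' t) M)
    ((measurableSet_coversOn _).preimage (f := fun w : EnvPath × EnvPath => (w.1 t, w.2 t))
      (by fun_prop)) hle

/-- The walks can be `2 * t` apart at the covering time `t`; from then on the environment seen by
the first one, translated by `2 * t`, lies below the environment seen by the second one. -/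
theorem CoversAt.approxLift_walk {r₁ r₂ p ν p₀ p₁ : ℝ} {l H t M L : ℕ}
    (h : E.CoversAt r₁ r₂ l H t M p) (hE : E.MarkovInvariant) (hN : E.NoDriftIn ν) (hp : p₀ ≤ p₁)
    (hM : L ≤ M - 2 * ν * L) {η₁ η₂ : Config} (h₁ : η₁.translate (2 * t) ∈ sparseConfigs r₁ l H)
    (h₂ : η₂ ∈ denseConfigs r₂ l H) (u : ℕ → unitInterval) :
    ApproxLift (fun ζ₁ ζ₂ => ∀ s ≤ L, walk p₀ p₁ ζ₁ u s - 2 * t ≤ walk p₀ p₁ ζ₂ u s)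
      (E.P η₁) (E.P η₂) (ENNReal.ofReal p + ENNReal.ofReal (20 * Real.exp (-(ν * L / 4)))) := by
  have before : ∀ ζ₁ ζ₂, ∀ s ≤ t, walk p₀ p₁ ζ₁ u s - 2 * t ≤ walk p₀ p₁ ζ₂ u s := by
    intro ζ₁ ζ₂ s hs
    have b₁ := abs_le.1 (abs_walk_le p₀ p₁ u ζ₁ s)
    have b₂ := abs_le.1 (abs_walk_le p₀ p₁ u ζ₂ s)
    omega
  have glued := (h.approxLift hE h₁ h₂).compProd (κ := E.restart t) (κ' := E.restart t)
    (S := fun w w' => ∀ s ≤ L, walk p₀ p₁ (glue t w.1 w.2) u s - 2 * t ≤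
      walk p₀ p₁ (glue t w'.1 w'.2) u s) fun ζ₁ ζ₂ hcov =>
    (hN.approxLift hE hcov L).mono (fun ξ₁ ξ₂ hξ s hs => ?_) le_rfl
  · simpa only [hE.map_glue] using glued.map (measurable_glue t) (measurable_glue t)
      (R' := fun ζ₁ ζ₂ => ∀ s ≤ L, walk p₀ p₁ ζ₁ u s - 2 * t ≤ walk p₀ p₁ ζ₂ u s)
      fun _ _ h => h
  · rcases le_total s t with hst | hts
    · exact before _ _ s hst
    · refine walk_sub_le_walk hp u (even_two_mul _) (before _ _ t le_rfl) (fun r htr hrL => ?_)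
        hts hs
      obtain ⟨i, rfl⟩ := Nat.exists_eq_add_of_le htr
      simpa only [glue_add] using (hξ i (by omega)).mono hM

end Environment

namespace Environment

variable {E : Environment} {p₀ p₁ ρ ρ' : ℝ} {L N : ℕ} {D : ℤ} {δ : ℝ≥0∞}

/-- Up to probability `δ`, the walks in the environments started from `μ ρ` and `μ ρ'` can be
coupled over a block of length `L` so that the first one gains at most `D` on the second one,
uniformly in their starting points in `[-N, N]`. The initial configurations are only controlled
through the good sets `S` and `T`. -/
def BlockCoupling (E : Environment) (p₀ p₁ ρ ρ' : ℝ) (L N : ℕ) (D : ℤ) (δ : ℝ≥0∞) : Prop :=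
  ∃ (S T : Set Config) (δ' : ℝ≥0∞), MeasurableSet S ∧ MeasurableSet T ∧
    E.μ ρ Sᶜ + E.μ ρ' Tᶜ + δ' ≤ δ ∧
    ∀ η₁ ∈ S, ∀ η₂ ∈ T, ∀ (u : ℕ → unitInterval) (x₁ x₂ : ℤ), |x₁| ≤ N → |x₂| ≤ N →
      ApproxLift (fun ξ₁ ξ₂ => ∀ s ≤ L,
        walk p₀ p₁ (ξ₁.translate x₁) u s - D ≤ walk p₀ p₁ (ξ₂.translate x₂) u s)
        (E.P η₁) (E.P η₂) δ'

theorem CoversAt.blockCoupling {r₁ r₂ p ν : ℝ} {l H t M : ℕ} (h : E.CoversAt r₁ r₂ l H t M p)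
    (hE : E.MarkovInvariant) (hN : E.NoDriftIn ν) (hp : p₀ ≤ p₁) (hM : L ≤ M - 2 * ν * L)
    (hδ : E.μ ρ (sparseConfigs r₁ l (H + 2 * t + N))ᶜ +
      E.μ ρ' (denseConfigs r₂ l (H + 2 * t + N))ᶜ +
      (ENNReal.ofReal p + ENNReal.ofReal (20 * Real.exp (-(ν * L / 4)))) ≤ δ) :
    E.BlockCoupling p₀ p₁ ρ ρ' L N (2 * t) δ := by
  refine ⟨_, _, _, measurableSet_sparseConfigs _ _ _, measurableSet_denseConfigs _ _ _, hδ, ?_⟩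
  intro η₁ h₁ η₂ h₂ u x₁ x₂ hx₁ hx₂
  have hs : (η₁.translate x₁).translate (2 * t) ∈ sparseConfigs r₁ l H := by
    refine translate_mem_sparseConfigs (H' := H + 2 * t) ?_ (by simp [abs_mul])
    exact translate_mem_sparseConfigs h₁ (by push_cast; omega)
  have hd : η₂.translate x₂ ∈ denseConfigs r₂ l H :=
    translate_mem_denseConfigs h₂ (by push_cast; omega)
  exact hE.approxLift_translate (h.approxLift_walk hE hN hp hM hs hd u)

theorem BlockCoupling.extend (h : E.BlockCoupling p₀ p₁ ρ ρ' L N D δ) {W₁ W₂ : Measure EnvPath}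
    [IsProbabilityMeasure W₁] [IsProbabilityMeasure W₂] {R : EnvPath → EnvPath → Prop} {γ : ℝ≥0∞}
    (hR : ApproxLift R W₁ W₂ γ) {m₁ m₂ : ℕ} (hW₁ : W₁.map (fun ζ => ζ m₁) = E.μ ρ)
    (hW₂ : W₂.map (fun ζ => ζ m₂) = E.μ ρ') {X₁ X₂ : EnvPath → ℤ} (hX₁ : ∀ ζ, |X₁ ζ| ≤ N)
    (hX₂ : ∀ ζ, |X₂ ζ| ≤ N) (u : ℕ → unitInterval) :
    ApproxLift (fun w₁ w₂ => R w₁.1 w₂.1 ∧ ∀ s ≤ L,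
        walk p₀ p₁ (w₁.2.translate (X₁ w₁.1)) u s - D ≤
          walk p₀ p₁ (w₂.2.translate (X₂ w₂.1)) u s)
      (W₁ ⊗ₘ E.restart m₁) (W₂ ⊗ₘ E.restart m₂) (γ + δ) := by
  obtain ⟨S, T, δ', hS, hT, hδ, hwalk⟩ := h
  have hgood := hR.restrict (S := (fun ζ => ζ m₁) ⁻¹' S) (T := (fun ζ => ζ m₂) ⁻¹' T)
    (measurable_pi_apply m₁ hS) (measurable_pi_apply m₂ hT)
  rw [← Set.preimage_compl, ← Set.preimage_compl, ← Measure.map_apply (measurable_pi_apply m₁)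
    hS.compl, ← Measure.map_apply (measurable_pi_apply m₂) hT.compl, hW₁, hW₂] at hgood
  refine (hgood.compProd (S := fun w₁ w₂ => R w₁.1 w₂.1 ∧ ∀ s ≤ L,
    walk p₀ p₁ (w₁.2.translate (X₁ w₁.1)) u s - D ≤ walk p₀ p₁ (w₂.2.translate (X₂ w₂.1)) u s)
    fun ζ₁ ζ₂ ⟨hζ, h₁, h₂⟩ => ?_).mono (fun _ _ => id) (by rw [add_assoc]; gcongr)
  exact (hwalk _ h₁ _ h₂ u _ _ (hX₁ ζ₁) (hX₂ ζ₂)).mono (fun _ _ hw => ⟨hζ, hw⟩) le_rfl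

theorem Monotonicity.approxLift_annealed (h : E.Monotonicity) (hρ : ρ ∈ E.J) (hρ' : ρ' ∈ E.J)
    (hle : ρ ≤ ρ') : ApproxLift (· ≤ ·) (E.annealed ρ) (E.annealed ρ') 0 := by
  have := (ApproxLift.of_stochLE (h.2 ρ hρ ρ' hρ' hle)).compProd (κ := E.P) (κ' := E.P)
    (S := fun w w' => w.2 ≤ w'.2) fun η η' hη => .of_stochLE (h.1 η η' hη)
  have := this.map measurable_snd measurable_snd (R' := (· ≤ ·)) fun _ _ h => h
  rwa [zero_add, ← Measure.snd, ← Measure.snd, Measure.snd_compProd, Measure.snd_compProd] at this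

theorem Monotonicity.approxLift_walk (h : E.Monotonicity) (hρ : ρ ∈ E.J) (hρ' : ρ' ∈ E.J)
    (hle : ρ ≤ ρ') (hp : p₀ ≤ p₁) (u : ℕ → unitInterval) :
    ApproxLift (fun ζ₁ ζ₂ => ∀ s, walk p₀ p₁ ζ₁ u s ≤ walk p₀ p₁ ζ₂ u s)
      (E.annealed ρ) (E.annealed ρ') 0 := by
  refine (h.approxLift_annealed hρ hρ' hle).mono (fun ζ₁ ζ₂ hζ s => ?_) le_rfl
  have := walk_sub_le_walk hp u (ζ₁ := ζ₁) (ζ₂ := ζ₂) (D := 0) (m := 0) (n := s)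
    .zero (by simp [walk]) (fun r _ _ x _ _ => by rw [Config.translate_zero]; exact hζ r x)
    s.zero_le le_rfl
  rwa [sub_zero] at this

end Environment

/-! ### Resampled environments -/

theorem measurable_upTo (n : ℕ) : Measurable (upTo n) := by
  unfold upTo
  fun_prop

section Sequences

variable {α : Type*}

/-- The sequence `a, ω 0, ω 1, …`. -/
def prepend (a : α) (ω : ℕ → α) : ℕ → α
  | 0 => a
  | n + 1 => ω n

@[fun_prop]
theorem measurable_prepend [MeasurableSpace α] :
    Measurable fun w : α × (ℕ → α) => prepend w.1 w.2 := by
  refine measurable_pi_lambda _ fun n => ?_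
  cases n <;> simp only [prepend] <;> fun_prop

theorem prepend_preimage_pi (s : Finset ℕ) (t : ℕ → Set α) :
    (fun w : α × (ℕ → α) => prepend w.1 w.2) ⁻¹' Set.pi s t =
      {a | 0 ∈ s → a ∈ t 0} ×ˢ
        Set.pi ((s.erase 0).image Nat.pred : Finset ℕ) fun i => t (i + 1) := by
  ext w
  constructor
  · refine fun h => ⟨fun h0 => h 0 h0, fun i hi => ?_⟩
    obtain ⟨k, hk, rfl⟩ := Finset.mem_image.1 hi
    obtain ⟨hk0, hk⟩ := Finset.mem_erase.1 hk
    obtain ⟨k, rfl⟩ := Nat.exists_eq_succ_of_ne_zero hk0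
    exact h (k + 1) hk
  · rintro ⟨h0, h⟩ (_ | i) hi
    · exact h0 hi
    · exact h i (Finset.mem_coe.2 (Finset.mem_image.2
        ⟨i + 1, Finset.mem_erase.2 ⟨i.succ_ne_zero, hi⟩, rfl⟩))

variable [MeasurableSpace α] (μ : Measure α) [IsProbabilityMeasure μ]

theorem map_prepend_infinitePi :
    (μ.prod (Measure.infinitePi fun _ : ℕ => μ)).map (fun w => prepend w.1 w.2) =
      Measure.infinitePi fun _ : ℕ => μ := by
  refine Measure.eq_infinitePi _ fun s t ht => ?_
  have hinj : Set.InjOn Nat.pred (s.erase 0 : Finset ℕ) := fun i hi k hk hik =>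
    Nat.pred_inj (Nat.pos_of_ne_zero (Finset.ne_of_mem_erase hi))
      (Nat.pos_of_ne_zero (Finset.ne_of_mem_erase hk)) hik
  have hsucc : ∏ i ∈ s.erase 0, μ (t (i.pred + 1)) = ∏ i ∈ s.erase 0, μ (t i) :=
    Finset.prod_congr rfl fun i hi => by
      rw [Nat.pred_eq_sub_one, Nat.sub_add_cancel (Nat.pos_of_ne_zero (Finset.ne_of_mem_erase hi))]
  rw [Measure.map_apply measurable_prepend (.pi s.countable_toSet fun i _ => ht i),
    prepend_preimage_pi, Measure.prod_prod, Measure.infinitePi_pi _ fun i _ => ht (i + 1),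
    Finset.prod_image hinj, hsucc]
  by_cases h0 : 0 ∈ s
  · simp [h0, Finset.mul_prod_erase s (fun i => μ (t i))]
  · simp [h0]

theorem map_shift_infinitePi (m : ℕ) :
    (Measure.infinitePi fun _ : ℕ => μ).map (fun u k => u (m + k)) =
      Measure.infinitePi fun _ : ℕ => μ := by
  induction m with
  | zero => simp
  | succ m ih =>
    conv_lhs => rw [← map_prepend_infinitePi μ]
    rw [Measure.map_map (by fun_prop) (by fun_prop)]
    have : (fun (u : ℕ → α) k => u (m + 1 + k)) ∘ (fun w : α × (ℕ → α) => prepend w.1 w.2) =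
        (fun u k => u (m + k)) ∘ Prod.snd := by
      funext w k
      simp only [Function.comp_apply, Nat.add_right_comm m 1 k, prepend]
    rw [this, ← Measure.map_map (by fun_prop) (by fun_prop), ← Measure.snd, Measure.snd_prod, ih]

end Sequences

namespace Environment

variable {E : Environment} {ρ : ℝ} {L : ℕ}

theorem concat_prepend (hL : 0 < L) (ζ : EnvPath) (ω : ℕ → EnvPath) :
    concat L (prepend ζ ω) = glue L ζ (concat L ω) := by
  funext t
  by_cases ht : t < L
  · simp [concat, glue, ht, Nat.div_eq_of_lt, Nat.mod_eq_of_lt, prepend]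
  · obtain ⟨s, rfl⟩ := Nat.exists_eq_add_of_le (not_lt.1 ht)
    simp [concat, Nat.add_div_left _ hL, prepend]

theorem finiteRange_eq_map_glue (ρ : ℝ) (hL : 0 < L) : E.finiteRange ρ L =
    ((E.annealed ρ).prod (E.finiteRange ρ L)).map fun w => glue L w.1 w.2 := by
  have hc := measurable_concat L
  conv_rhs => rw [← Measure.map_id (μ := E.annealed ρ)]
  rw [finiteRange, Measure.map_prod_map _ _ measurable_id hc, Measure.map_map (by fun_prop)
    (by fun_prop)]
  conv_lhs => rw [← map_prepend_infinitePi, Measure.map_map hc (by fun_prop)]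
  congr 1
  funext w
  exact concat_prepend hL w.1 w.2

/-- A sequence of laws of environments that are renewed at the multiples of `L`: `V k` evolves
freely after time `k * L`, and `V (k + 1)` only differs from it from time `(k + 1) * L` on. -/
structure IsBlockSequence (E : Environment) (ρ : ℝ) (L : ℕ) (V : ℕ → Measure EnvPath) :
    Prop where
  zero : V 0 = E.annealed ρ
  succ (k : ℕ) : ∃ κ : Kernel EnvPath EnvPath, IsMarkovKernel κ ∧
    V (k + 1) = (V k ⊗ₘ κ).map fun w => glue ((k + 1) * L) w.1 w.2
  map_apply (k : ℕ) : (V k).map (fun ζ => ζ (k * L)) = E.μ ρ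
  map_glue_restart (k : ℕ) :
    (V k ⊗ₘ E.restart (k * L)).map (fun w => glue (k * L) w.1 w.2) = V k

theorem IsBlockSequence.annealed (hE : E.MarkovInvariant) (hS : E.Stationary) (hρ : ρ ∈ E.J)
    (L : ℕ) : E.IsBlockSequence ρ L fun _ => E.annealed ρ where
  zero := rfl
  succ k := ⟨E.restart ((k + 1) * L), inferInstance, (hE.annealed_map_glue ρ _).symm⟩
  map_apply _ := hS.annealed_map_apply hρ _
  map_glue_restart _ := hE.annealed_map_glue ρ _

/-- The law of the environment that is resampled from `μ ρ` at the times `L, 2 * L, …, k * L`. -/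
def resampled (E : Environment) (ρ : ℝ) (L : ℕ) : ℕ → Measure EnvPath
  | 0 => E.annealed ρ
  | k + 1 => ((resampled E ρ L k).prod (E.annealed ρ)).map fun w => glue ((k + 1) * L) w.1 w.2

instance isProbabilityMeasure_resampled (k : ℕ) : IsProbabilityMeasure (E.resampled ρ L k) := by
  induction k with
  | zero => unfold resampled; infer_instance
  | succ k ih => exact Measure.isProbabilityMeasure_map (by fun_prop)

theorem MarkovInvariant.prod_annealed_map_glue (hE : E.MarkovInvariant) (μ : Measure EnvPath)
    [IsProbabilityMeasure μ] (ρ : ℝ) (m : ℕ) :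
    ((μ.prod (E.annealed ρ)).map (fun w => glue m w.1 w.2) ⊗ₘ E.restart m).map
      (fun w => glue m w.1 w.2) = (μ.prod (E.annealed ρ)).map fun w => glue m w.1 w.2 := by
  have := Measure.isProbabilityMeasure_map (μ := μ.prod (E.annealed ρ))
    (measurable_glue m).aemeasurable
  refine Measure.ext_of_lintegral _ fun f hf => ?_
  have hg : Measurable fun w : EnvPath × EnvPath => f (glue m w.1 w.2) := by fun_prop
  have hglue (ζ ξ θ : EnvPath) : glue m (glue m ζ ξ) θ = glue m ζ θ := by
    simpa using (glue_glue m 0 ζ ξ θ).symm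
  have hrestart : Measurable fun w : EnvPath × EnvPath =>
      ∫⁻ θ, f (glue m w.1 θ) ∂E.P (w.2 0) := by
    have := hg.lintegral_kernel_prod_right' (κ := E.restart m)
    simpa [Function.comp_def, hglue] using this.comp (measurable_glue m)
  rw [lintegral_map hf (by fun_prop), Measure.lintegral_compProd hg,
    lintegral_map hg.lintegral_kernel_prod_right' (by fun_prop), lintegral_map hf (by fun_prop)]
  simp only [hglue, restart_apply, glue_self]
  rw [lintegral_prod _ hrestart.aemeasurable, lintegral_prod _ (by fun_prop)]
  refine lintegral_congr fun ζ => ?_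
  conv_rhs => rw [← hE.annealed_map_glue ρ 0, lintegral_map (by fun_prop) (by fun_prop),
    Measure.lintegral_compProd (by fun_prop)]
  simp

theorem IsBlockSequence.resampled (hE : E.MarkovInvariant) (ρ : ℝ) (L : ℕ) :
    E.IsBlockSequence ρ L (E.resampled ρ L) where
  zero := rfl
  succ k := ⟨Kernel.const _ (E.annealed ρ), inferInstance, by
    rw [Measure.compProd_const, Environment.resampled]⟩
  map_apply k := by
    cases k with
    | zero => simpa [Environment.resampled] using annealed_map_apply_zero ρ
    | succ k =>
      rw [Environment.resampled, Measure.map_map (by fun_prop) (by fun_prop)]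
      have : ((fun ζ : EnvPath => ζ ((k + 1) * L)) ∘ fun w : EnvPath × EnvPath =>
          glue ((k + 1) * L) w.1 w.2) = (fun ζ => ζ 0) ∘ Prod.snd :=
        funext fun w => glue_self _ _ _
      rw [this, ← Measure.map_map (by fun_prop) (by fun_prop), ← Measure.snd, Measure.snd_prod,
        annealed_map_apply_zero]
  map_glue_restart k := by
    cases k with
    | zero => simpa [Environment.resampled] using hE.annealed_map_glue ρ 0
    | succ k => exact hE.prod_annealed_map_glue _ ρ _

theorem finiteRange_eq_map_glue_resampled (ρ : ℝ) (hL : 0 < L) (k : ℕ) : E.finiteRange ρ L =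
    ((E.resampled ρ L k).prod (E.finiteRange ρ L)).map fun w => glue ((k + 1) * L) w.1 w.2 := by
  induction k with
  | zero => simpa [resampled] using finiteRange_eq_map_glue ρ hL
  | succ k ih =>
    have hL' := measurable_glue L
    have hk := measurable_glue ((k + 1) * L)
    conv_lhs => rw [ih, finiteRange_eq_map_glue ρ hL, ← Measure.map_id (μ := E.resampled ρ L k),
      Measure.map_prod_map _ _ measurable_id hL', ← Measure.prodAssoc_prod,
      Measure.map_map (by fun_prop) (by fun_prop), Measure.map_map (by fun_prop) (by fun_prop)]
    conv_rhs => rw [resampled, ← Measure.map_id (μ := E.finiteRange ρ L),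
      Measure.map_prod_map _ _ hk measurable_id, Measure.map_map (by fun_prop) (by fun_prop)]
    congr 1
    funext w
    have := glue_glue ((k + 1) * L) L w.1.1 w.1.2 w.2
    rwa [← add_one_mul] at this

end Environment

/-- The law of the variables driving the walk. -/
abbrev driverLaw : Measure (ℕ → unitInterval) := Measure.infinitePi fun _ => volume

theorem measurable_upTo_walk (p₀ p₁ : ℝ) (n : ℕ) :
    Measurable fun w : EnvPath × (ℕ → unitInterval) => upTo n (walk p₀ p₁ w.1 w.2) :=
  (measurable_upTo n).comp (measurable_walk p₀ p₁)

theorem walkLaw_map_upTo {E : Environment} {L : ℕ} (p₀ p₁ ρ : ℝ) (hL : 0 < L) {k n : ℕ}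
    (hn : n ≤ (k + 1) * L) : (walkLaw E p₀ p₁ ρ L).map (upTo n) =
      ((E.resampled ρ L k).prod driverLaw).map fun w => upTo n (walk p₀ p₁ w.1 w.2) := by
  have hw := measurable_upTo_walk p₀ p₁ n
  have hV : (E.resampled ρ L k).prod driverLaw =
      (((E.resampled ρ L k).prod (E.finiteRange ρ L)).prod driverLaw).map
        (Prod.map Prod.fst id) := by
    rw [← Measure.map_prod_map _ _ measurable_fst measurable_id, Measure.map_id, ← Measure.fst,
      Measure.fst_prod]
  calc (walkLaw E p₀ p₁ ρ L).map (upTo n)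
    _ = ((E.finiteRange ρ L).prod driverLaw).map fun w => upTo n (walk p₀ p₁ w.1 w.2) :=
        Measure.map_map (measurable_upTo n) (measurable_walk p₀ p₁)
    _ = (((E.resampled ρ L k).prod (E.finiteRange ρ L)).prod driverLaw).map
          fun w => upTo n (walk p₀ p₁ (glue ((k + 1) * L) w.1.1 w.1.2) w.2) := by
        conv_lhs => rw [Environment.finiteRange_eq_map_glue_resampled ρ hL k,
          ← Measure.map_id (μ := driverLaw), Measure.map_prod_map _ _ (measurable_glue _)
            measurable_id, Measure.map_map hw (by fun_prop)]
        rfl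
    _ = (((E.resampled ρ L k).prod (E.finiteRange ρ L)).prod driverLaw).map
          fun w => upTo n (walk p₀ p₁ w.1.1 w.2) := by
        congr 1
        funext w s
        exact walk_glue_of_le p₀ p₁ _ _ _ ((Nat.lt_succ_iff.1 s.2).trans hn)
    _ = _ := by rw [hV, Measure.map_map hw (by fun_prop)]; rfl

/-! ### Gluing blocks -/

namespace Environment

variable {E : Environment} {p₀ p₁ ρ ρ' : ℝ} {L N : ℕ} {D : ℤ} {δ : ℝ≥0∞}
  {V₁ V₂ : ℕ → Measure EnvPath}

theorem IsBlockSequence.isProbabilityMeasure {V : ℕ → Measure EnvPath}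
    (h : E.IsBlockSequence ρ L V) (k : ℕ) : IsProbabilityMeasure (V k) := by
  have : IsProbabilityMeasure ((V k).map fun ζ => ζ (k * L)) := h.map_apply k ▸ inferInstance
  exact Measure.isProbabilityMeasure_of_map fun ζ => ζ (k * L)

theorem IsBlockSequence.approxLift_succ (h₁ : E.IsBlockSequence ρ L V₁)
    (h₂ : E.IsBlockSequence ρ' L V₂) (u : ℕ → unitInterval) {k : ℕ}
    (h : ApproxLift (fun ζ₁ ζ₂ => ∀ s ≤ (k + 1) * L, walk p₀ p₁ ζ₁ u s - D ≤ walk p₀ p₁ ζ₂ u s)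
      (V₁ k) (V₂ k) δ) :
    ApproxLift (fun ζ₁ ζ₂ => ∀ s ≤ (k + 1) * L, walk p₀ p₁ ζ₁ u s - D ≤ walk p₀ p₁ ζ₂ u s)
      (V₁ (k + 1)) (V₂ (k + 1)) δ := by
  have := h₁.isProbabilityMeasure k
  have := h₂.isProbabilityMeasure k
  obtain ⟨κ₁, _, hκ₁⟩ := h₁.succ k
  obtain ⟨κ₂, _, hκ₂⟩ := h₂.succ k
  rw [hκ₁, hκ₂]
  refine ((h.compProd (κ := κ₁) (κ' := κ₂) (S := fun w₁ w₂ => ∀ s ≤ (k + 1) * L,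
    walk p₀ p₁ w₁.1 u s - D ≤ walk p₀ p₁ w₂.1 u s) fun ζ₁ ζ₂ hζ =>
      ApproxLift.of_true.mono (fun _ _ _ => hζ) le_rfl).map (measurable_glue _)
        (measurable_glue _) fun w₁ w₂ hw s hs => ?_).mono (fun _ _ => id) (add_zero δ).le
  rw [walk_glue_of_le p₀ p₁ u _ _ hs, walk_glue_of_le p₀ p₁ u _ _ hs]
  exact hw s hs

theorem walk_glue_sub_le {m k : ℕ} {D : ℤ} (hD : 0 ≤ D) {u : ℕ → unitInterval}
    {ζ₁ ζ₂ ξ₁ ξ₂ : EnvPath}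
    (hm : ∀ s ≤ m, walk p₀ p₁ ζ₁ u s - k * D ≤ walk p₀ p₁ ζ₂ u s)
    (hL : ∀ s ≤ L, walk p₀ p₁ (ξ₁.translate (walk p₀ p₁ ζ₁ u m)) (fun i => u (m + i)) s - D ≤
      walk p₀ p₁ (ξ₂.translate (walk p₀ p₁ ζ₂ u m)) (fun i => u (m + i)) s) {s : ℕ}
    (hs : s ≤ m + L) :
    walk p₀ p₁ (glue m ζ₁ ξ₁) u s - (k + 1 : ℕ) * D ≤ walk p₀ p₁ (glue m ζ₂ ξ₂) u s := by
  push_cast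
  rcases le_total s m with hsm | hms
  · rw [walk_glue_of_le p₀ p₁ u _ _ hsm, walk_glue_of_le p₀ p₁ u _ _ hsm]
    linarith [hm s hsm]
  · obtain ⟨i, rfl⟩ := Nat.exists_eq_add_of_le hms
    rw [walk_glue_add, walk_glue_add]
    linarith [hm m le_rfl, hL i (by omega)]

theorem BlockCoupling.approxLift_walk (h : E.BlockCoupling p₀ p₁ ρ ρ' L N D δ)
    (hM : E.Monotonicity) (hρ : ρ ∈ E.J) (hρ' : ρ' ∈ E.J) (hle : ρ ≤ ρ') (hp : p₀ ≤ p₁)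
    (hD : 0 ≤ D) (h₁ : E.IsBlockSequence ρ L V₁) (h₂ : E.IsBlockSequence ρ' L V₂)
    (u : ℕ → unitInterval) {k : ℕ} (hk : k * L ≤ N) :
    ApproxLift (fun ζ₁ ζ₂ => ∀ s ≤ (k + 1) * L,
      walk p₀ p₁ ζ₁ u s - k * D ≤ walk p₀ p₁ ζ₂ u s) (V₁ k) (V₂ k) (k * δ) := by
  induction k with
  | zero =>
    rw [h₁.zero, h₂.zero]
    refine (hM.approxLift_walk hρ hρ' hle hp u).mono (fun ζ₁ ζ₂ hζ s _ => ?_) zero_le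
    simpa using hζ s
  | succ k ih =>
    have := h₁.isProbabilityMeasure (k + 1)
    have := h₂.isProbabilityMeasure (k + 1)
    have hpos (ζ : EnvPath) : |walk p₀ p₁ ζ u ((k + 1) * L)| ≤ N :=
      (abs_walk_le p₀ p₁ u ζ _).trans (by exact_mod_cast hk)
    have extended := (h.extend (h₁.approxLift_succ h₂ u (ih (le_trans (by gcongr; simp) hk)))
      (h₁.map_apply _) (h₂.map_apply _) hpos hpos fun i => u ((k + 1) * L + i)).map
        (measurable_glue ((k + 1) * L)) (measurable_glue ((k + 1) * L))
        (R' := fun ζ₁ ζ₂ => ∀ s ≤ (k + 1 + 1) * L,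
          walk p₀ p₁ ζ₁ u s - (k + 1 : ℕ) * D ≤ walk p₀ p₁ ζ₂ u s)
        fun w₁ w₂ hw s hs => walk_glue_sub_le hD hw.1 hw.2 (by rwa [← add_one_mul])
    rw [h₁.map_glue_restart, h₂.map_glue_restart] at extended
    exact extended.mono (fun _ _ => id) (by push_cast; rw [add_one_mul])

end Environment

theorem measure_map_upTo_compl_eq_zero (μ : Measure EnvPath) (p₀ p₁ : ℝ) (n : ℕ) :
    (μ.prod driverLaw).map (fun w => upTo n (walk p₀ p₁ w.1 w.2))
      (Fintype.piFinset fun _ => Finset.Icc (-n : ℤ) n : Finset (Fin (n + 1) → ℤ))ᶜ = 0 := by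
  rw [Measure.map_apply (measurable_upTo_walk p₀ p₁ n) (by measurability)]
  refine (measure_mono_null (t := ∅) (fun w hw => hw ?_) measure_empty)
  simp only [Finset.mem_coe, Fintype.mem_piFinset, Finset.mem_Icc]
  intro s
  have hs : (s : ℤ) ≤ n := by omega
  exact ⟨(neg_le_neg hs).trans (abs_le.1 (abs_walk_le p₀ p₁ w.2 w.1 s)).1,
    (abs_le.1 (abs_walk_le p₀ p₁ w.2 w.1 s)).2.trans hs⟩

namespace Environment

theorem BlockCoupling.exists_isCoupling {E : Environment} {p₀ p₁ ρ ρ' d : ℝ} {L N : ℕ} {D : ℤ}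
    {V₁ V₂ : ℕ → Measure EnvPath} (h : E.BlockCoupling p₀ p₁ ρ ρ' L N D (ENNReal.ofReal d))
    (hd : 0 ≤ d) (hM : E.Monotonicity) (hρ : ρ ∈ E.J) (hρ' : ρ' ∈ E.J) (hle : ρ ≤ ρ')
    (hp : p₀ ≤ p₁) (hD : 0 ≤ D) (h₁ : E.IsBlockSequence ρ L V₁)
    (h₂ : E.IsBlockSequence ρ' L V₂) {k n : ℕ} (hk : k * L ≤ N) (hn : n ≤ (k + 1) * L) :
    ∃ Q, IsCoupling Q
        (((V₁ k).prod driverLaw).map fun w => upTo n (walk p₀ p₁ w.1 w.2))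
        (((V₂ k).prod driverLaw).map fun w => upTo n (walk p₀ p₁ w.1 w.2)) ∧
      Q.real {w | ¬ ∀ s, w.1 s - k * D ≤ w.2 s} ≤ k * d := by
  have := h₁.isProbabilityMeasure k
  have := h₂.isProbabilityMeasure k
  have hmeas := measurable_upTo_walk p₀ p₁ n
  have := Measure.isProbabilityMeasure_map (μ := (V₁ k).prod driverLaw) hmeas.aemeasurable
  have := Measure.isProbabilityMeasure_map (μ := (V₂ k).prod driverLaw) hmeas.aemeasurable
  refine ApproxLift.exists_isCoupling (measure_map_upTo_compl_eq_zero (V₁ k) p₀ p₁ n)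
    (measure_map_upTo_compl_eq_zero (V₂ k) p₀ p₁ n) (R := fun X₁ X₂ => ∀ s, X₁ s - k * D ≤ X₂ s)
    (by positivity) (ApproxLift.map_prod hmeas hmeas fun u => ?_)
  rw [ENNReal.ofReal_mul (by positivity), ENNReal.ofReal_natCast]
  exact (h.approxLift_walk hM hρ hρ' hle hp hD h₁ h₂ u hk).map
    (hmeas.comp measurable_prodMk_right) (hmeas.comp measurable_prodMk_right)
    fun ζ₁ ζ₂ hζ s => hζ s ((Nat.lt_succ_iff.1 s.2).trans hn)

end Environment

/-! ### Expected positions -/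

namespace Environment

variable {E : Environment} {p₀ p₁ ρ ρ' d : ℝ} {L N : ℕ} {D : ℤ}

/-- The expected position at time `m` of the walk driven by `u` in the environment that is never
resampled. -/
def drivenMean (E : Environment) (p₀ p₁ ρ : ℝ) (u : ℕ → unitInterval) (m : ℕ) : ℝ :=
  ∫ ζ, (walk p₀ p₁ ζ u m : ℝ) ∂E.annealed ρ

/-- The expected position at time `m` of the walk in the environment that is never resampled. -/
def mean (E : Environment) (p₀ p₁ ρ : ℝ) (m : ℕ) : ℝ :=
  ∫ u, E.drivenMean p₀ p₁ ρ u m ∂driverLaw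

theorem abs_cast_walk_le (u : ℕ → unitInterval) (ζ : EnvPath) (m : ℕ) :
    |(walk p₀ p₁ ζ u m : ℝ)| ≤ m := by
  exact_mod_cast abs_walk_le p₀ p₁ u ζ m

theorem measurable_cast_walk_left (u : ℕ → unitInterval) (m : ℕ) :
    Measurable fun ζ : EnvPath => (walk p₀ p₁ ζ u m : ℝ) :=
  measurable_from_top.comp (measurable_walk_left p₀ p₁ u m)

theorem measurable_cast_walk (m : ℕ) :
    Measurable fun w : EnvPath × (ℕ → unitInterval) => (walk p₀ p₁ w.1 w.2 m : ℝ) :=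
  measurable_from_top.comp ((measurable_pi_apply m).comp (measurable_walk p₀ p₁))

theorem integrable_walk_left (μ : Measure EnvPath) [IsFiniteMeasure μ] (u : ℕ → unitInterval)
    (m : ℕ) : Integrable (fun ζ => (walk p₀ p₁ ζ u m : ℝ)) μ :=
  .of_bound (measurable_cast_walk_left u m).aestronglyMeasurable m
    (.of_forall fun ζ => abs_cast_walk_le u ζ m)

theorem integrable_walk (μ : Measure (EnvPath × (ℕ → unitInterval))) [IsFiniteMeasure μ]
    (m : ℕ) : Integrable (fun w => (walk p₀ p₁ w.1 w.2 m : ℝ)) μ :=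
  .of_bound (measurable_cast_walk m).aestronglyMeasurable m
    (.of_forall fun w => abs_cast_walk_le w.2 w.1 m)

theorem mean_eq_integral_prod (m : ℕ) : E.mean p₀ p₁ ρ m =
    ∫ w, (walk p₀ p₁ w.1 w.2 m : ℝ) ∂(E.annealed ρ).prod driverLaw :=
  (integral_prod_symm _ (integrable_walk _ m)).symm

theorem integrable_drivenMean (m : ℕ) :
    Integrable (fun u => E.drivenMean p₀ p₁ ρ u m) driverLaw :=
  (integrable_walk ((E.annealed ρ).prod driverLaw) m).integral_prod_right

theorem measurePreserving_shift (k : ℕ) :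
    MeasurePreserving (fun (u : ℕ → unitInterval) i => u (k + i)) driverLaw driverLaw :=
  ⟨by fun_prop, map_shift_infinitePi volume k⟩

theorem integrable_drivenMean_shift (k m : ℕ) :
    Integrable (fun u => E.drivenMean p₀ p₁ ρ (fun i => u (k + i)) m) driverLaw :=
  (measurePreserving_shift k).integrable_comp_of_integrable (integrable_drivenMean m)

theorem integral_drivenMean_shift (k m : ℕ) :
    ∫ u, E.drivenMean p₀ p₁ ρ (fun i => u (k + i)) m ∂driverLaw = E.mean p₀ p₁ ρ m := by
  have hmap := (measurePreserving_shift k).map_eq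
  rw [← integral_map (φ := fun (u : ℕ → unitInterval) i => u (k + i))
    (f := fun u => E.drivenMean p₀ p₁ ρ u m) (measurePreserving_shift k).aemeasurable
    (by rw [hmap]; exact (integrable_drivenMean m).1), hmap, mean]

theorem integrable_drivenMean_shift_sub (k m m' : ℕ) :
    Integrable (fun u => E.drivenMean p₀ p₁ ρ (fun i => u (k + i)) m -
      E.drivenMean p₀ p₁ ρ (fun i => u (k + i)) m') driverLaw :=
  (integrable_drivenMean_shift k m).sub (integrable_drivenMean_shift k m')

theorem integral_drivenMean_shift_sub (k m m' : ℕ) :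
    ∫ u, (E.drivenMean p₀ p₁ ρ (fun i => u (k + i)) m -
      E.drivenMean p₀ p₁ ρ (fun i => u (k + i)) m') ∂driverLaw =
      E.mean p₀ p₁ ρ m - E.mean p₀ p₁ ρ m' := by
  rw [integral_sub (integrable_drivenMean_shift k m) (integrable_drivenMean_shift k m'),
    integral_drivenMean_shift, integral_drivenMean_shift]

@[simp]
theorem mean_zero : E.mean p₀ p₁ ρ 0 = 0 := by simp [mean, drivenMean, walk]

theorem abs_mean_add_sub_le (E : Environment) (p₀ p₁ ρ : ℝ) (m r : ℕ) :
    |E.mean p₀ p₁ ρ (m + r) - E.mean p₀ p₁ ρ m| ≤ r := by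
  rw [mean_eq_integral_prod, mean_eq_integral_prod, ← integral_sub (integrable_walk _ _)
    (integrable_walk _ _)]
  have := norm_integral_le_of_norm_le_const (μ := (E.annealed ρ).prod driverLaw) (C := r)
    (f := fun w => (walk p₀ p₁ w.1 w.2 (m + r) : ℝ) - walk p₀ p₁ w.1 w.2 m)
    (.of_forall fun w => by
      rw [Real.norm_eq_abs]
      exact_mod_cast abs_walk_add_sub_le p₀ p₁ w.2 w.1 m r)
  simpa using this

theorem speed_eq_mean_div (ρ : ℝ) (hL : 0 < L) :
    speed E p₀ p₁ ρ L = E.mean p₀ p₁ ρ L / L := by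
  have hX : Measurable fun X : Fin (L + 1) → ℤ => (X (Fin.last L) : ℝ) / L := by fun_prop
  calc speed E p₀ p₁ ρ L
    _ = ∫ X, (X (Fin.last L) : ℝ) / L ∂(walkLaw E p₀ p₁ ρ L).map (upTo L) := by
        rw [integral_map (measurable_upTo L).aemeasurable hX.aestronglyMeasurable]
        rfl
    _ = ∫ w, (walk p₀ p₁ w.1 w.2 L : ℝ) / L ∂(E.annealed ρ).prod driverLaw := by
        rw [walkLaw_map_upTo (k := 0) p₀ p₁ ρ hL (by simp),
          integral_map (measurable_upTo_walk p₀ p₁ L).aemeasurable hX.aestronglyMeasurable]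
        rfl
    _ = _ := by rw [integral_div, mean_eq_integral_prod]

theorem abs_speed_le_one (E : Environment) (p₀ p₁ ρ : ℝ) (hL : 0 < L) :
    |speed E p₀ p₁ ρ L| ≤ 1 := by
  have hL' : (0 : ℝ) < L := by exact_mod_cast hL
  rw [speed_eq_mean_div ρ hL, abs_div, Nat.abs_cast, div_le_one hL']
  simpa using abs_mean_add_sub_le E p₀ p₁ ρ 0 L

theorem Monotonicity.mean_le (h : E.Monotonicity) (hρ : ρ ∈ E.J) (hρ' : ρ' ∈ E.J) (hle : ρ ≤ ρ')
    (hp : p₀ ≤ p₁) (m : ℕ) : E.mean p₀ p₁ ρ m ≤ E.mean p₀ p₁ ρ' m := by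
  refine integral_mono (integrable_drivenMean m) (integrable_drivenMean m) fun u => ?_
  have hlift := (h.approxLift_walk hρ hρ' hle hp u).mono (δ' := ENNReal.ofReal 0)
    (fun _ _ => id) (by simp)
  have key := hlift.integral_le le_rfl (measurable_cast_walk_left u m)
    (measurable_cast_walk_left u m) (integrable_walk_left _ u m) (integrable_walk_left _ u m)
    (K := 2 * m) (by positivity) (fun ζ₁ ζ₂ hζ => by exact_mod_cast hζ m) fun ζ₁ ζ₂ => by
      linarith [(abs_le.1 (abs_cast_walk_le (p₀ := p₀) (p₁ := p₁) u ζ₁ m)).2,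
        (abs_le.1 (abs_cast_walk_le (p₀ := p₀) (p₁ := p₁) u ζ₂ m)).1]
  rwa [mul_zero, add_zero] at key

/-- The displacement over the times `m, …, m + n` of the walk driven by `u` in the environment
which follows `w.1` up to time `m` and `w.2` afterwards. -/
def gluedIncrement (p₀ p₁ : ℝ) (u : ℕ → unitInterval) (m n : ℕ) (w : EnvPath × EnvPath) : ℤ :=
  walk p₀ p₁ (glue m w.1 w.2) u (m + n) - walk p₀ p₁ (glue m w.1 w.2) u m

theorem gluedIncrement_eq (u : ℕ → unitInterval) (m n : ℕ) (w : EnvPath × EnvPath) :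
    gluedIncrement p₀ p₁ u m n w =
      walk p₀ p₁ (w.2.translate (walk p₀ p₁ w.1 u m)) (fun i => u (m + i)) n := by
  rw [gluedIncrement, walk_glue_add, walk_glue_of_le _ _ _ _ _ le_rfl, add_sub_cancel_left]

theorem measurable_gluedIncrement (u : ℕ → unitInterval) (m n : ℕ) :
    Measurable fun w => (gluedIncrement p₀ p₁ u m n w : ℝ) := by
  unfold gluedIncrement
  fun_prop

theorem abs_gluedIncrement_le (u : ℕ → unitInterval) (m n : ℕ) (w : EnvPath × EnvPath) :
    |(gluedIncrement p₀ p₁ u m n w : ℝ)| ≤ n := by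
  exact_mod_cast abs_walk_add_sub_le p₀ p₁ u _ m n

theorem integrable_gluedIncrement (μ : Measure (EnvPath × EnvPath)) [IsFiniteMeasure μ]
    (u : ℕ → unitInterval) (m n : ℕ) :
    Integrable (fun w => (gluedIncrement p₀ p₁ u m n w : ℝ)) μ :=
  .of_bound (measurable_gluedIncrement u m n).aestronglyMeasurable n
    (.of_forall fun w => abs_gluedIncrement_le u m n w)

theorem MarkovInvariant.drivenMean_add_sub (hE : E.MarkovInvariant) (ρ : ℝ)
    (u : ℕ → unitInterval) (m n : ℕ) :
    E.drivenMean p₀ p₁ ρ u (m + n) - E.drivenMean p₀ p₁ ρ u m =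
      ∫ w, (gluedIncrement p₀ p₁ u m n w : ℝ) ∂(E.annealed ρ ⊗ₘ E.restart m) := by
  rw [drivenMean, drivenMean, ← integral_sub (integrable_walk_left _ _ _)
    (integrable_walk_left _ _ _)]
  nth_rw 1 [← hE.annealed_map_glue ρ m]
  rw [integral_map (by fun_prop) (by fun_prop)]
  simp only [gluedIncrement, Int.cast_sub]

theorem BlockCoupling.drivenMean_add_sub_le
    (h : E.BlockCoupling p₀ p₁ ρ ρ' L N D (ENNReal.ofReal d)) (hd : 0 ≤ d)
    (hE : E.MarkovInvariant) (hS : E.Stationary) (hρ : ρ ∈ E.J) (hρ' : ρ' ∈ E.J) (hD : 0 ≤ D)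
    {m₁ m₂ : ℕ} (hm₁ : m₁ ≤ N) (hm₂ : m₂ ≤ N) {u₁ u₂ : ℕ → unitInterval}
    (hu : ∀ i, u₁ (m₁ + i) = u₂ (m₂ + i)) :
    E.drivenMean p₀ p₁ ρ u₁ (m₁ + L) - E.drivenMean p₀ p₁ ρ u₁ m₁ ≤
      E.drivenMean p₀ p₁ ρ' u₂ (m₂ + L) - E.drivenMean p₀ p₁ ρ' u₂ m₂ + (D + 2 * L * d) := by
  have hX {m : ℕ} (hm : m ≤ N) (u : ℕ → unitInterval) (ζ : EnvPath) :
      |walk p₀ p₁ ζ u m| ≤ N :=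
    (abs_walk_le p₀ p₁ u ζ m).trans (by exact_mod_cast hm)
  have hlift := h.extend .of_true (hS.annealed_map_apply hρ m₁) (hS.annealed_map_apply hρ' m₂)
    (hX hm₁ u₁) (hX hm₂ u₂) fun i => u₁ (m₁ + i)
  rw [zero_add] at hlift
  have hD' : (0 : ℝ) ≤ D := by exact_mod_cast hD
  have key := hlift.integral_le hd (measurable_gluedIncrement (p₀ := p₀) (p₁ := p₁) u₁ m₁ L)
    ((measurable_gluedIncrement (p₀ := p₀) (p₁ := p₁) u₂ m₂ L).add_const (D : ℝ))
    (integrable_gluedIncrement _ _ _ _)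
    ((integrable_gluedIncrement _ _ _ _).add (integrable_const _)) (K := 2 * L) (by positivity)
    (fun w₁ w₂ ⟨_, hw⟩ => by
      rw [gluedIncrement_eq, gluedIncrement_eq, ← sub_le_iff_le_add]
      simp only [hu] at hw ⊢
      exact_mod_cast hw L le_rfl)
    fun w₁ w₂ => by
      linarith [(abs_le.1 (abs_gluedIncrement_le (p₀ := p₀) (p₁ := p₁) u₁ m₁ L w₁)).2,
        (abs_le.1 (abs_gluedIncrement_le (p₀ := p₀) (p₁ := p₁) u₂ m₂ L w₂)).1]
  rw [integral_add (integrable_gluedIncrement _ _ _ _) (integrable_const _), integral_const,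
    probReal_univ, one_smul] at key
  rw [hE.drivenMean_add_sub, hE.drivenMean_add_sub]
  linarith

theorem BlockCoupling.mean_add_sub_le
    (h : E.BlockCoupling p₀ p₁ ρ ρ' L N D (ENNReal.ofReal d)) (hd : 0 ≤ d)
    (hE : E.MarkovInvariant) (hS : E.Stationary) (hρ : ρ ∈ E.J) (hρ' : ρ' ∈ E.J) (hD : 0 ≤ D)
    {m₁ m₂ : ℕ} (hm₁ : m₁ ≤ N) (hm₂ : m₂ ≤ N) :
    E.mean p₀ p₁ ρ (m₁ + L) - E.mean p₀ p₁ ρ m₁ ≤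
      E.mean p₀ p₁ ρ' (m₂ + L) - E.mean p₀ p₁ ρ' m₂ + (D + 2 * L * d) := by
  have key := integral_mono (integrable_drivenMean_shift_sub m₂ (m₁ + L) m₁)
    ((integrable_drivenMean_shift_sub m₁ (m₂ + L) m₂).add (integrable_const _)) fun u =>
    h.drivenMean_add_sub_le hd hE hS hρ hρ' hD hm₁ hm₂ (u₁ := fun i => u (m₂ + i))
      (u₂ := fun i => u (m₁ + i)) fun i => by rw [add_left_comm]
  simp only [Pi.add_apply] at key
  rwa [integral_add (integrable_drivenMean_shift_sub _ _ _) (integrable_const _),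
    integral_drivenMean_shift_sub, integral_drivenMean_shift_sub, integral_const, probReal_univ,
    one_smul] at key

theorem BlockCoupling.mean_le_mul (h : E.BlockCoupling p₀ p₁ ρ ρ' L N D (ENNReal.ofReal d))
    (hd : 0 ≤ d) (hE : E.MarkovInvariant) (hS : E.Stationary) (hM : E.Monotonicity)
    (hρ : ρ ∈ E.J) (hρ' : ρ' ∈ E.J) (hle : ρ ≤ ρ') (hp : p₀ ≤ p₁) (hD : 0 ≤ D) {k : ℕ}
    (hk : k * L ≤ N) :
    E.mean p₀ p₁ ρ ((k + 1) * L) ≤ (k + 1) * E.mean p₀ p₁ ρ' L + k * (D + 2 * L * d) := by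
  induction k with
  | zero => simpa using hM.mean_le hρ hρ' hle hp L
  | succ k ih =>
    have := h.mean_add_sub_le hd hE hS hρ hρ' hD hk N.zero_le
    rw [← add_one_mul, zero_add, mean_zero, sub_zero] at this
    have := ih (le_trans (by gcongr; simp) hk)
    push_cast
    linarith

theorem BlockCoupling.mul_mean_le (h : E.BlockCoupling p₀ p₁ ρ ρ' L N D (ENNReal.ofReal d))
    (hd : 0 ≤ d) (hE : E.MarkovInvariant) (hS : E.Stationary) (hM : E.Monotonicity)
    (hρ : ρ ∈ E.J) (hρ' : ρ' ∈ E.J) (hle : ρ ≤ ρ') (hp : p₀ ≤ p₁) (hD : 0 ≤ D) {k : ℕ}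
    (hk : k * L ≤ N) :
    (k + 1) * E.mean p₀ p₁ ρ L ≤ E.mean p₀ p₁ ρ' ((k + 1) * L) + k * (D + 2 * L * d) := by
  induction k with
  | zero => simpa using hM.mean_le hρ hρ' hle hp L
  | succ k ih =>
    have := h.mean_add_sub_le hd hE hS hρ hρ' hD N.zero_le hk
    rw [← add_one_mul, zero_add, mean_zero, sub_zero] at this
    have := ih (le_trans (by gcongr; simp) hk)
    push_cast
    linarith

end Environment

namespace Environment

variable {E : Environment} {p₀ p₁ ρ ρ' d : ℝ} {L N : ℕ} {D : ℤ}

theorem mean_eq_mul_speed (ρ : ℝ) (hL : 0 < L) :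
    E.mean p₀ p₁ ρ L = L * speed E p₀ p₁ ρ L := by
  rw [speed_eq_mean_div ρ hL, mul_div_cancel₀ _ (by positivity)]

theorem BlockCoupling.speed_le (h : E.BlockCoupling p₀ p₁ ρ ρ' L N D (ENNReal.ofReal d))
    (hd : 0 ≤ d) (hE : E.MarkovInvariant) (hS : E.Stationary) (hM : E.Monotonicity)
    (hρ : ρ ∈ E.J) (hρ' : ρ' ∈ E.J) (hle : ρ ≤ ρ') (hp : p₀ ≤ p₁) (hD : 0 ≤ D) (hL : 0 < L)
    {k n r : ℕ} (hk : k * L ≤ N) (hn : n = (k + 1) * L + r) :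
    speed E p₀ p₁ ρ n ≤ speed E p₀ p₁ ρ' L + 2 * (r / n) + k * (D / n) + 2 * k * d := by
  have hn' : (n : ℝ) = (k + 1) * L + r := by exact_mod_cast hn
  have hLn : (L : ℝ) ≤ n := by
    exact_mod_cast hn ▸ (Nat.le_mul_of_pos_left L k.succ_pos).trans (Nat.le_add_right _ _)
  have hn₀ : (0 : ℝ) < n := lt_of_lt_of_le (by positivity) hLn
  have hblocks := h.mean_le_mul hd hE hS hM hρ hρ' hle hp hD hk
  have hrest := (abs_le.1 (abs_mean_add_sub_le E p₀ p₁ ρ ((k + 1) * L) r)).2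
  rw [← hn, mean_eq_mul_speed ρ (by exact_mod_cast hn₀)] at hrest
  rw [mean_eq_mul_speed ρ' hL] at hblocks
  have hv := mul_le_mul_of_nonneg_left (abs_le.1 (abs_speed_le_one E p₀ p₁ ρ' hL)).1
    (r.cast_nonneg (α := ℝ))
  have hkd : k * (2 * L * d) ≤ k * (2 * n * d) := by gcongr
  rw [← mul_le_mul_iff_right₀ hn₀]
  field_simp
  linear_combination hrest + hblocks + hv + hkd - speed E p₀ p₁ ρ' L * hn'

theorem BlockCoupling.le_speed (h : E.BlockCoupling p₀ p₁ ρ ρ' L N D (ENNReal.ofReal d))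
    (hd : 0 ≤ d) (hE : E.MarkovInvariant) (hS : E.Stationary) (hM : E.Monotonicity)
    (hρ : ρ ∈ E.J) (hρ' : ρ' ∈ E.J) (hle : ρ ≤ ρ') (hp : p₀ ≤ p₁) (hD : 0 ≤ D) (hL : 0 < L)
    {k n r : ℕ} (hk : k * L ≤ N) (hn : n = (k + 1) * L + r) :
    speed E p₀ p₁ ρ L ≤ speed E p₀ p₁ ρ' n + 2 * (r / n) + k * (D / n) + 2 * k * d := by
  have hn' : (n : ℝ) = (k + 1) * L + r := by exact_mod_cast hn
  have hLn : (L : ℝ) ≤ n := by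
    exact_mod_cast hn ▸ (Nat.le_mul_of_pos_left L k.succ_pos).trans (Nat.le_add_right _ _)
  have hn₀ : (0 : ℝ) < n := lt_of_lt_of_le (by positivity) hLn
  have hblocks := h.mul_mean_le hd hE hS hM hρ hρ' hle hp hD hk
  have hrest := (abs_le.1 (abs_mean_add_sub_le E p₀ p₁ ρ' ((k + 1) * L) r)).1
  rw [← hn, mean_eq_mul_speed ρ' (by exact_mod_cast hn₀)] at hrest
  rw [mean_eq_mul_speed ρ hL] at hblocks
  have hv := mul_le_mul_of_nonneg_left (abs_le.1 (abs_speed_le_one E p₀ p₁ ρ hL)).2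
    (r.cast_nonneg (α := ℝ))
  have hkd : k * (2 * L * d) ≤ k * (2 * n * d) := by gcongr
  rw [← mul_le_mul_iff_right₀ hn₀]
  field_simp
  linear_combination hrest + hblocks + hv + hkd + speed E p₀ p₁ ρ L * hn'

end Environment

/-! ### Sparse and dense initial configurations -/

theorem measure_exists_interval_le (μ : Measure Config) {B : ℤ → ℕ → Set Config} {b : ℝ} {l H : ℕ}
    (hb : 0 ≤ b) (hl : 1 ≤ l / 2) (h : ∀ a m, l / 2 ≤ m → μ (B a m) ≤ ENNReal.ofReal b) :
    μ {η | ∃ (a : ℤ) (m : ℕ), l / 2 ≤ m ∧ m ≤ l ∧ -(H : ℤ) ≤ a ∧ a + m - 1 ≤ H ∧ η ∈ B a m} ≤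
      ENNReal.ofReal ((2 * H + 1) * (l + 1) * b) := by
  set intervals := Finset.Icc (-(H : ℤ)) H ×ˢ Finset.Icc (l / 2) l
  have hcard : (intervals.card : ℝ) ≤ (2 * H + 1) * (l + 1) := by
    rw [Finset.card_product, Int.card_Icc, Nat.card_Icc,
      show ((H : ℤ) + 1 - -(H : ℤ)).toNat = 2 * H + 1 by omega]
    exact_mod_cast Nat.mul_le_mul_left _ (Nat.sub_le (l + 1) (l / 2))
  calc μ {η | ∃ (a : ℤ) (m : ℕ), l / 2 ≤ m ∧ m ≤ l ∧ -(H : ℤ) ≤ a ∧ a + m - 1 ≤ H ∧ η ∈ B a m}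
      ≤ μ (⋃ w ∈ intervals, B w.1 w.2) := by
        refine measure_mono ?_
        rintro η ⟨a, m, h₁, h₂, h₃, h₄, h₅⟩
        refine Set.mem_biUnion (x := (a, m)) ?_ h₅
        simp only [intervals, Finset.coe_product, Finset.coe_Icc, Set.mem_prod, Set.mem_Icc]
        omega
    _ ≤ ∑ w ∈ intervals, μ (B w.1 w.2) := measure_biUnion_finset_le _ _
    _ ≤ ∑ _w ∈ intervals, ENNReal.ofReal b := Finset.sum_le_sum fun w hw =>
        h _ _ (Finset.mem_Icc.1 (Finset.mem_product.1 hw).2).1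
    _ = ENNReal.ofReal (intervals.card * b) := by
        rw [Finset.sum_const, nsmul_eq_mul, ENNReal.ofReal_mul (by positivity),
          ENNReal.ofReal_natCast]
    _ ≤ _ := ENNReal.ofReal_le_ofReal (mul_le_mul_of_nonneg_right hcard hb)

namespace Environment

variable {E : Environment}

theorem DensityAtStationarity.exists_measure_le (h : E.DensityAtStationarity) :
    ∃ c : ℝ, 0 < c ∧ ∀ ρ ∈ E.J, ∀ ε : ℝ, 0 < ε → ε < 1 → ∀ l : ℕ, 1 ≤ l → ∀ a : ℤ,
      E.μ ρ {η | ε * l ≤ |(particles η a l : ℝ) - ρ * l|} ≤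
        ENNReal.ofReal (2 * Real.exp (-(c * ε ^ 2 * l))) := by
  obtain ⟨c, hc, h⟩ := h
  refine ⟨c, hc, fun ρ hρ ε hε hε₁ l hl a => ?_⟩
  have hmeas : MeasurableSet {η : Config | ε * l ≤ |(particles η a l : ℝ) - ρ * l|} := by
    have : Measurable fun η : Config => (particles η a l : ℝ) :=
      measurable_from_nat.comp (measurable_particles a l)
    exact measurableSet_le measurable_const (this.sub_const _).abs
  rw [← annealed_map_apply_zero, Measure.map_apply (measurable_pi_apply 0) hmeas,
    ← ofReal_measureReal]
  exact ENNReal.ofReal_le_ofReal (h ρ hρ ε hε hε₁ l hl a)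

theorem DensityAtStationarity.exists_measure_compl_le (h : E.DensityAtStationarity) :
    ∃ c : ℝ, 0 < c ∧ ∀ ρ ∈ E.J, ∀ ε : ℝ, 0 < ε → ε < 1 → ∀ (r : ℝ) (l H : ℕ), 1 ≤ l / 2 →
      (ρ + ε ≤ r → E.μ ρ (sparseConfigs r l H)ᶜ ≤ ENNReal.ofReal
        ((2 * H + 1) * (l + 1) * (2 * Real.exp (-(c * ε ^ 2 * (l / 2 : ℕ)))))) ∧
      (r + ε ≤ ρ → E.μ ρ (denseConfigs r l H)ᶜ ≤ ENNReal.ofReal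
        ((2 * H + 1) * (l + 1) * (2 * Real.exp (-(c * ε ^ 2 * (l / 2 : ℕ)))))) := by
  obtain ⟨c, hc, h⟩ := h.exists_measure_le
  refine ⟨c, hc, fun ρ hρ ε hε hε₁ r l H hl => ?_⟩
  have hdev := measure_exists_interval_le (E.μ ρ) (H := H)
    (B := fun a m => {η | ε * m ≤ |(particles η a m : ℝ) - ρ * m|})
    (b := 2 * Real.exp (-(c * ε ^ 2 * (l / 2 : ℕ)))) (by positivity) hl fun a m hm =>
      (h ρ hρ ε hε hε₁ m (hl.trans hm) a).trans (by gcongr)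
  refine ⟨fun hr => (measure_mono fun η hη => ?_).trans hdev,
    fun hr => (measure_mono fun η hη => ?_).trans hdev⟩
  · simp only [sparseConfigs, Set.mem_compl_iff, Set.mem_ofPred_eq, not_forall, not_le] at hη
    obtain ⟨a, m, h₁, h₂, h₃, h₄, h₅⟩ := hη
    have hrm := mul_le_mul_of_nonneg_right hr (m.cast_nonneg (α := ℝ))
    have hdiff : ε * m ≤ particles η a m - ρ * m := by linarith
    exact ⟨a, m, h₁, h₂, h₃, h₄, hdiff.trans (le_abs_self _)⟩
  · simp only [denseConfigs, Set.mem_compl_iff, Set.mem_ofPred_eq, not_forall, not_le] at hη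
    obtain ⟨a, m, h₁, h₂, h₃, h₄, h₅⟩ := hη
    have hrm := mul_le_mul_of_nonneg_right hr (m.cast_nonneg (α := ℝ))
    have hdiff : ε * m ≤ -(particles η a m - ρ * m) := by linarith
    exact ⟨a, m, h₁, h₂, h₃, h₄, hdiff.trans (neg_le_abs _)⟩

theorem CoversAt.mono {r₁ r₂ p q : ℝ} {l H t M : ℕ} (h : E.CoversAt r₁ r₂ l H t M p)
    (hpq : p ≤ q) : E.CoversAt r₁ r₂ l H t M q := fun η₁ h₁ η₂ h₂ =>
  (h η₁ h₁ η₂ h₂).imp fun _ hQ => ⟨hQ.1, (sub_le_sub_left hpq 1).trans hQ.2⟩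

theorem Covering.exists_coversAt {ν : ℝ} (h : E.Covering ν) (hν : 0 < ν) :
    ∃ C C' : ℝ, 0 < C ∧ 0 < C' ∧ ∀ ρ ∈ E.J, ∀ ε : ℝ, 0 < ε → ε < 1 → ρ + ε ∈ E.J →
      ∀ H t M : ℕ, 1 ≤ t → M + 4 * ν * t ≤ H → 0 < M → 1 < ν ^ 8 * t →
      C * (ε ^ 2)⁻¹ * (1 + |Real.log (ν * t) ^ 3|) < ν * (t : ℝ) ^ (1 / 4 : ℝ) →
      E.CoversAt (ρ + ε / 4) (ρ + 3 * ε / 4) ⌊(t : ℝ) ^ (1 / 4 : ℝ)⌋₊ H t M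
        (C' * t * H * Real.exp (-((C' * (1 + ν⁻¹))⁻¹ * ε ^ 2 * (t : ℝ) ^ (1 / 4 : ℝ)))) := by
  obtain ⟨C, C', hC, hC', h⟩ := h
  refine ⟨C, C', hC, hC', fun ρ hρ ε hε hε₁ hρε H t M ht hH hM hνt hlog η₁ h₁ η₂ h₂ => ?_⟩
  have hM' : (0 : ℝ) < M := by exact_mod_cast hM
  have hH₀ : 4 * ν * t < H := by linarith
  have hH₁ : (0 : ℝ) < H := lt_of_le_of_lt (by positivity) hH₀
  obtain ⟨Q, hQ, hle⟩ := h ρ hρ ε hε hε₁ hρε H t (by exact_mod_cast hH₁) ht hH₀ hνt hlog _ rfl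
    η₂ η₁ fun a m ha hm h₃ h₄ => ⟨h₂ a m ha hm h₃ h₄, h₁ a m ha hm h₃ h₄⟩
  have : IsProbabilityMeasure (Q.map Prod.fst) := hQ.1 ▸ inferInstance
  have := Measure.isProbabilityMeasure_of_map (μ := Q) Prod.fst
  exact ⟨Q, hQ, hle.trans (measureReal_mono fun w hw => CoversOn.mono hw (by linarith))⟩

end Environment

/-! ### Choice of scales -/

theorem exists_mul_exp_le (B : ℝ) {κ : ℝ} (hκ : 0 < κ) :
    ∃ x₀ : ℝ, ∀ x ≥ x₀, B * Real.exp (2 * x - κ * x ^ 8) ≤ Real.exp (-x) := by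
  refine ⟨max 1 ((3 + |B|) / κ), fun x hx => ?_⟩
  obtain ⟨hx₁, hxB⟩ := max_le_iff.1 hx
  rw [div_le_iff₀ hκ] at hxB
  have hpow : κ * x * x ≤ κ * x ^ 8 := by
    rw [mul_assoc, ← sq]
    gcongr
    norm_num
  have hexponent : |B| + (2 * x - κ * x ^ 8) ≤ -x := by
    nlinarith [mul_le_mul_of_nonneg_right hxB (by linarith : 0 ≤ x), abs_nonneg B]
  calc B * Real.exp (2 * x - κ * x ^ 8) ≤ Real.exp |B| * Real.exp (2 * x - κ * x ^ 8) := by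
        gcongr
        linarith [le_abs_self B, Real.add_one_le_exp |B|]
    _ = Real.exp (|B| + (2 * x - κ * x ^ 8)) := (Real.exp_add _ _).symm
    _ ≤ Real.exp (-x) := Real.exp_le_exp.2 hexponent

/-- The time after which the environments are coupled when their densities differ by at least
`x⁻¹`. Walks drift apart by at most twice this time, which is less than the loss `x ^ 40` allowed
over a block. -/
def coverTime (x : ℝ) : ℕ := ⌊x ^ 40 / 8⌋₊

/-- The largest length of the intervals on which densities are compared. -/
def coverScale (x : ℝ) : ℕ := ⌊(coverTime x : ℝ) ^ (1 / 4 : ℝ)⌋₊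

section Scales

variable {x ν : ℝ}

theorem coverTime_le (x : ℝ) : (coverTime x : ℝ) ≤ x ^ 40 / 8 :=
  Nat.floor_le (by positivity)

theorem le_coverTime (hx : 16 ≤ x) : x ^ 40 / 16 ≤ coverTime x := by
  have hfloor : x ^ 40 / 8 < (coverTime x : ℝ) + 1 := Nat.lt_floor_add_one _
  have hpow : (16 : ℝ) ≤ x ^ 40 := hx.trans (le_self_pow₀ (by linarith) (by norm_num))
  linarith

theorem one_le_coverTime (hx : 16 ≤ x) : 1 ≤ coverTime x := by
  have hpow : (16 : ℝ) ≤ x ^ 40 := hx.trans (le_self_pow₀ (by linarith) (by norm_num))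
  exact_mod_cast (show (1 : ℝ) ≤ coverTime x by linarith [le_coverTime hx])

theorem le_coverTime_rpow (hx : 16 ≤ x) : x ^ 10 / 2 ≤ (coverTime x : ℝ) ^ (1 / 4 : ℝ) := by
  rw [one_div, Real.le_rpow_inv_iff_of_pos (by positivity) (by positivity) (by norm_num)]
  convert le_coverTime hx using 1
  norm_cast
  ring

theorem coverScale_add_one_le (hx : 16 ≤ x) : (coverScale x : ℝ) + 1 ≤ x ^ 40 := by
  have ht : (1 : ℝ) ≤ coverTime x := by exact_mod_cast one_le_coverTime hx
  have hscale : (coverScale x : ℝ) ≤ coverTime x :=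
    (Nat.floor_le (by positivity)).trans
      (Real.rpow_le_self_of_one_le ht (by norm_num))
  linarith [coverTime_le x]

theorem le_coverScale_div_two (hx : 16 ≤ x) : x ^ 10 / 8 ≤ (coverScale x / 2 : ℕ) := by
  have hpow : (16 : ℝ) ≤ x ^ 10 := hx.trans (le_self_pow₀ (by linarith) (by norm_num))
  have hfloor : (coverTime x : ℝ) ^ (1 / 4 : ℝ) < coverScale x + 1 := Nat.lt_floor_add_one _
  have hhalf : (coverScale x : ℝ) ≤ 2 * (coverScale x / 2 : ℕ) + 1 := by
    exact_mod_cast (by omega)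
  linarith [le_coverTime_rpow hx]

theorem one_le_coverScale_div_two (hx : 16 ≤ x) : 1 ≤ coverScale x / 2 := by
  have hpow : (16 : ℝ) ≤ x ^ 10 := hx.trans (le_self_pow₀ (by linarith) (by norm_num))
  exact_mod_cast (show (1 : ℝ) ≤ (coverScale x / 2 : ℕ) by linarith [le_coverScale_div_two hx])

theorem one_lt_pow_mul_coverTime (hν : 0 < ν) (hx : 16 ≤ x) (hνx : ν⁻¹ ≤ x) :
    1 < ν ^ 8 * coverTime x := by
  have hνx' : 1 ≤ ν * x := (inv_le_iff_one_le_mul₀' hν).1 hνx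
  have hpow : (16 : ℝ) ^ 2 ≤ x ^ 32 :=
    (pow_le_pow_left₀ (by norm_num) hx 2).trans (pow_le_pow_right₀ (by linarith) (by norm_num))
  calc (1 : ℝ) < 1 ^ 8 * 16 ^ 2 / 16 := by norm_num
    _ ≤ (ν * x) ^ 8 * x ^ 32 / 16 := by gcongr
    _ = ν ^ 8 * (x ^ 40 / 16) := by ring
    _ ≤ ν ^ 8 * coverTime x := by gcongr; exact le_coverTime hx

theorem one_le_mul_coverTime (hν : 0 < ν) (hx : 16 ≤ x) (hνx : ν⁻¹ ≤ x) :
    1 ≤ ν * coverTime x := by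
  have hνx' : 1 ≤ ν * x := (inv_le_iff_one_le_mul₀' hν).1 hνx
  have hpow : (16 : ℝ) ≤ x ^ 39 := hx.trans (le_self_pow₀ (by linarith) (by norm_num))
  calc (1 : ℝ) = 1 * 16 / 16 := by norm_num
    _ ≤ (ν * x) * x ^ 39 / 16 := by gcongr
    _ = ν * (x ^ 40 / 16) := by ring
    _ ≤ ν * coverTime x := by gcongr; exact le_coverTime hx

theorem abs_log_mul_coverTime_pow_le (hν : 0 < ν) (hx : 16 ≤ x) (hνx : ν⁻¹ ≤ x) (hxν : ν ≤ x) :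
    |Real.log (ν * coverTime x) ^ 3| ≤ (41 * x) ^ 3 := by
  have hx₀ : 0 < x := by linarith
  have hone := one_le_mul_coverTime hν hx hνx
  have hle : ν * coverTime x ≤ x ^ 41 := by
    calc ν * coverTime x ≤ x * x ^ 40 := by
          gcongr
          exact (coverTime_le x).trans (div_le_self (by positivity) (by norm_num))
      _ = x ^ 41 := by ring
  have hlog : Real.log (ν * coverTime x) ≤ 41 * x := by
    calc Real.log (ν * coverTime x) ≤ Real.log (x ^ 41) :=
          Real.log_le_log (by linarith) hle
      _ = 41 * Real.log x := by rw [Real.log_pow]; norm_num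
      _ ≤ 41 * x := by gcongr; exact Real.log_le_self hx₀.le
  have hlog₀ := Real.log_nonneg hone
  rw [abs_of_nonneg (by positivity)]
  gcongr

theorem covering_threshold_lt {C : ℝ} (hν : 0 < ν) (hC : 0 < C) (hx : 16 ≤ x) (hνx : ν⁻¹ ≤ x)
    (hxν : ν ≤ x) (hxC : 2 * (1 + 41 ^ 3) * C / ν < x) :
    C * (x⁻¹ ^ 2)⁻¹ * (1 + |Real.log (ν * coverTime x) ^ 3|) <
      ν * (coverTime x : ℝ) ^ (1 / 4 : ℝ) := by
  have hx₁ : 1 ≤ x := by linarith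
  rw [div_lt_iff₀ hν] at hxC
  calc C * (x⁻¹ ^ 2)⁻¹ * (1 + |Real.log (ν * coverTime x) ^ 3|)
      ≤ C * (x⁻¹ ^ 2)⁻¹ * (x ^ 3 + (41 * x) ^ 3) := by
        gcongr
        · exact one_le_pow₀ hx₁
        · exact abs_log_mul_coverTime_pow_le hν hx hνx hxν
    _ = 2 * (1 + 41 ^ 3) * C * x ^ 5 / 2 := by rw [inv_pow, inv_inv]; ring
    _ < x * ν * x ^ 5 / 2 := by gcongr
    _ = ν * (x ^ 6 / 2) := by ring
    _ ≤ ν * (x ^ 10 / 2) := by gcongr; norm_num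
    _ ≤ _ := by gcongr; exact le_coverTime_rpow hx

end Scales

namespace Environment

variable {E : Environment}

theorem DensityAtStationarity.exists_measure_compl_coverScale_le (h : E.DensityAtStationarity) :
    ∃ κ : ℝ, 0 < κ ∧ ∀ x : ℝ, 16 ≤ x → ∀ ρ ∈ E.J, ∀ (r : ℝ) (H : ℕ),
      (ρ + x⁻¹ / 4 ≤ r → E.μ ρ (sparseConfigs r (coverScale x) H)ᶜ ≤
        ENNReal.ofReal (2 * (2 * H + 1) * x ^ 40 * Real.exp (-(κ * x ^ 8)))) ∧
      (r + x⁻¹ / 4 ≤ ρ → E.μ ρ (denseConfigs r (coverScale x) H)ᶜ ≤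
        ENNReal.ofReal (2 * (2 * H + 1) * x ^ 40 * Real.exp (-(κ * x ^ 8)))) := by
  obtain ⟨c, hc, h⟩ := h.exists_measure_compl_le
  refine ⟨c / 128, by positivity, fun x hx ρ hρ r H => ?_⟩
  have : 0 < x := by linarith
  have hinv : x⁻¹ < 1 := inv_lt_one_of_one_lt₀ (by linarith)
  have hexponent : c / 128 * x ^ 8 ≤ c * (x⁻¹ / 4) ^ 2 * (coverScale x / 2 : ℕ) := by
    calc c / 128 * x ^ 8 = c * (x⁻¹ / 4) ^ 2 * (x ^ 10 / 8) := by field_simp; ring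
      _ ≤ _ := by gcongr; exact le_coverScale_div_two hx
  have hbound : (2 * H + 1) * ((coverScale x : ℝ) + 1) *
      (2 * Real.exp (-(c * (x⁻¹ / 4) ^ 2 * (coverScale x / 2 : ℕ)))) ≤
      2 * (2 * H + 1) * x ^ 40 * Real.exp (-(c / 128 * x ^ 8)) := by
    calc _ ≤ (2 * H + 1) * x ^ 40 * (2 * Real.exp (-(c / 128 * x ^ 8))) := by
          gcongr
          exact coverScale_add_one_le hx
      _ = _ := by ring
  exact (h ρ hρ (x⁻¹ / 4) (by positivity) (by linarith) r (coverScale x) H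
    (one_le_coverScale_div_two hx)).imp
      (fun hs hr => (hs hr).trans (ENNReal.ofReal_le_ofReal hbound))
      fun hd hr => (hd hr).trans (ENNReal.ofReal_le_ofReal hbound)

theorem Covering.exists_coversAt_coverTime {ν : ℝ} (h : E.Covering ν) (hν : 0 < ν) :
    ∃ C κ x₀ : ℝ, 0 < C ∧ 0 < κ ∧ ∀ x ≥ x₀, ∀ ρ ∈ E.J, ρ + x⁻¹ ∈ E.J → ∀ H M : ℕ, 0 < M →
      M + 4 * ν * coverTime x ≤ H →
      E.CoversAt (ρ + x⁻¹ / 4) (ρ + 3 * x⁻¹ / 4) (coverScale x) H (coverTime x) M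
        (C * H * x ^ 40 * Real.exp (-(κ * x ^ 8))) := by
  obtain ⟨C, C', hC, hC', h⟩ := h.exists_coversAt hν
  refine ⟨C', (C' * (1 + ν⁻¹))⁻¹ / 2,
    max 16 (max ν⁻¹ (max ν (2 * (1 + 41 ^ 3) * C / ν + 1))), hC', by positivity,
    fun x hx ρ hρ hρx H M hM hH => ?_⟩
  simp only [ge_iff_le, max_le_iff] at hx
  obtain ⟨hx, hνx, hxν, hxC⟩ := hx
  have : 0 < x := by linarith
  refine (h ρ hρ x⁻¹ (by positivity) (inv_lt_one_of_one_lt₀ (by linarith)) hρx H (coverTime x) M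
    (one_le_coverTime hx) hH hM (one_lt_pow_mul_coverTime hν hx hνx)
    (covering_threshold_lt hν hC hx hνx hxν (by linarith))).mono ?_
  have hexponent : (C' * (1 + ν⁻¹))⁻¹ / 2 * x ^ 8 ≤
      (C' * (1 + ν⁻¹))⁻¹ * x⁻¹ ^ 2 * (coverTime x : ℝ) ^ (1 / 4 : ℝ) := by
    calc (C' * (1 + ν⁻¹))⁻¹ / 2 * x ^ 8 = (C' * (1 + ν⁻¹))⁻¹ * x⁻¹ ^ 2 * (x ^ 10 / 2) := by
          field_simp
      _ ≤ _ := by gcongr; exact le_coverTime_rpow hx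
  calc _ ≤ C' * x ^ 40 * H * Real.exp (-((C' * (1 + ν⁻¹))⁻¹ / 2 * x ^ 8)) := by
        gcongr
        exact (coverTime_le x).trans (div_le_self (by positivity) (by norm_num))
    _ = _ := by ring

end Environment

theorem exists_window (ν : ℝ) {L t j : ℕ} (hL : 1 ≤ L) (ht : t ≤ L) (hj : 1 ≤ j) :
    ∃ H M : ℕ, 0 < M ∧ (L : ℝ) ≤ M - 2 * ν * L ∧ M + 4 * ν * t ≤ H ∧
      2 * ((H + 2 * t + j * L : ℕ) : ℝ) + 1 ≤ (11 + 12 * ⌈ν⌉₊) * (j * L) := by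
  refine ⟨(1 + 6 * ⌈ν⌉₊) * L + 1, (1 + 2 * ⌈ν⌉₊) * L, by positivity, ?_, ?_, ?_⟩
  · have hνL : ν * L ≤ ⌈ν⌉₊ * L := by gcongr; exact Nat.le_ceil ν
    push_cast
    linarith
  · have hνt : ν * t ≤ ⌈ν⌉₊ * L := by gcongr; exact Nat.le_ceil ν
    push_cast
    linarith
  · have hLj : L ≤ j * L := Nat.le_mul_of_pos_left L hj
    have hVLj : ⌈ν⌉₊ * L ≤ ⌈ν⌉₊ * (j * L) := Nat.mul_le_mul_left _ hLj
    norm_cast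
    linarith

section BlockErrors

variable {x κ A B : ℝ} {L : ℕ}

theorem mul_pow_mul_exp_le (hx : 1 ≤ x) (hxL : x ^ 400 ≤ L) (hLx : Real.log L ≤ x) (hA : 0 ≤ A)
    (hB : B ≤ A * L) {κ' : ℝ} (hκ : κ ≤ κ') :
    B * x ^ 40 * Real.exp (-(κ' * x ^ 8)) ≤ A * Real.exp (2 * x - κ * x ^ 8) := by
  have : 0 < x := by linarith
  have hL : (0 : ℝ) < L := (by positivity : 0 < x ^ 400).trans_le hxL
  have hL_exp : (L : ℝ) ≤ Real.exp x := (Real.log_le_iff_le_exp hL).1 hLx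
  have hpow : x ^ 40 ≤ L := (pow_le_pow_right₀ hx (by norm_num)).trans hxL
  calc B * x ^ 40 * Real.exp (-(κ' * x ^ 8)) ≤
        A * Real.exp x * Real.exp x * Real.exp (-(κ * x ^ 8)) := by
        gcongr
        · exact hB.trans (by gcongr)
        · exact hpow.trans hL_exp
    _ = A * Real.exp (2 * x - κ * x ^ 8) := by
        rw [mul_assoc A, mul_assoc A, ← Real.exp_add, ← Real.exp_add]
        ring_nf

theorem exp_neg_mul_div_four_le (hx : 1 ≤ x) (hxL : x ^ 400 ≤ L) {ν : ℝ} (hν : 0 ≤ ν)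
    (hκ : κ ≤ ν / 4) : Real.exp (-(ν * L / 4)) ≤ Real.exp (2 * x - κ * x ^ 8) := by
  have hpow : x ^ 8 ≤ L := (pow_le_pow_right₀ hx (by norm_num)).trans hxL
  have hκx : κ * x ^ 8 ≤ ν / 4 * L := by gcongr
  exact Real.exp_le_exp.2 (by linarith)

theorem add_block_errors_le {C κ₁ κ₂ ν : ℝ} {j H H' : ℕ} (hx : 1 ≤ x) (hxL : x ^ 400 ≤ L)
    (hLx : Real.log L ≤ x) (hj : 1 ≤ j) (hν : 0 ≤ ν) (hC : 0 ≤ C) (hA : 0 ≤ A)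
    (hκ₁ : κ ≤ κ₁) (hκ₂ : κ ≤ κ₂) (hκν : κ ≤ ν / 4) (hH : H ≤ H')
    (hH' : 2 * (H' : ℝ) + 1 ≤ A * (j * L))
    (hsmall : (4 * A + C * A + 20) * Real.exp (2 * x - κ * x ^ 8) ≤ Real.exp (-x)) :
    2 * (2 * H' + 1) * x ^ 40 * Real.exp (-(κ₁ * x ^ 8)) +
        2 * (2 * H' + 1) * x ^ 40 * Real.exp (-(κ₁ * x ^ 8)) +
        (C * H * x ^ 40 * Real.exp (-(κ₂ * x ^ 8)) + 20 * Real.exp (-(ν * L / 4))) ≤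
      j * Real.exp (-x) := by
  have hj' : (1 : ℝ) ≤ j := by exact_mod_cast hj
  have hHH' : (H : ℝ) ≤ H' := by exact_mod_cast hH
  have hdens := mul_pow_mul_exp_le hx hxL hLx (A := 2 * A * j) (by positivity)
    (B := 2 * (2 * H' + 1)) (by linarith) hκ₁
  have hcov := mul_pow_mul_exp_le hx hxL hLx (A := C * A * j) (by positivity) (B := C * H) (by
    rw [mul_assoc, mul_assoc]
    gcongr
    linarith [H'.cast_nonneg (α := ℝ)]) hκ₂
  have hdrift := (exp_neg_mul_div_four_le hx hxL hν hκν).trans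
    (le_mul_of_one_le_left (Real.exp_pos _).le hj')
  linarith [mul_le_mul_of_nonneg_left hsmall (by linarith : (0 : ℝ) ≤ j)]

end BlockErrors

namespace Environment

theorem exists_blockCoupling {E : Environment} {ν : ℝ} (hν : 0 < ν) (hE : E.MarkovInvariant)
    (hD : E.DensityAtStationarity) (hN : E.NoDriftIn ν) (hC : E.Covering ν) :
    ∃ x₀ : ℝ, ∀ x ≥ x₀, ∀ L : ℕ, x ^ 400 ≤ L → Real.log L ≤ x → ∀ ρ ∈ E.J, ∀ ρ' ∈ E.J,
      ρ + x⁻¹ ≤ ρ' → ∀ j : ℕ, 1 ≤ j → ∀ p₀ p₁ : ℝ, p₀ ≤ p₁ →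
      E.BlockCoupling p₀ p₁ ρ ρ' L (j * L) (2 * coverTime x)
        (ENNReal.ofReal (j * Real.exp (-x))) := by
  obtain ⟨κ₁, hκ₁, hdens⟩ := hD.exists_measure_compl_coverScale_le
  obtain ⟨C, κ₂, x₁, hC₀, hκ₂, hcov⟩ := hC.exists_coversAt_coverTime hν
  set κ := min κ₁ (min κ₂ (ν / 4))
  obtain ⟨hκκ₁, hκκ₂, hκν⟩ : κ ≤ κ₁ ∧ κ ≤ κ₂ ∧ κ ≤ ν / 4 := by simp [κ]
  set A : ℝ := 11 + 12 * ⌈ν⌉₊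
  obtain ⟨x₂, hx₂⟩ := exists_mul_exp_le (4 * A + C * A + 20) (κ := κ) (by positivity)
  refine ⟨max 16 (max x₁ x₂), fun x hx L hxL hLx ρ hρ ρ' hρ' hρρ' j hj p₀ p₁ hp => ?_⟩
  simp only [ge_iff_le, max_le_iff] at hx
  obtain ⟨hx, hxx₁, hxx₂⟩ := hx
  have hx₁ : 1 ≤ x := by linarith
  have hinv : 0 < x⁻¹ := by positivity
  have hL : (1 : ℝ) ≤ L := (one_le_pow₀ hx₁).trans hxL
  have ht : coverTime x ≤ L := by
    have hpow : x ^ 40 ≤ L := (pow_le_pow_right₀ hx₁ (by norm_num)).trans hxL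
    exact_mod_cast (coverTime_le x).trans ((div_le_self (by positivity) (by norm_num)).trans hpow)
  obtain ⟨H, M, hM, hLM, hMH, hH⟩ := exists_window ν (by exact_mod_cast hL) ht hj
  have hcovers := hcov x hxx₁ ρ hρ ⟨by linarith [hρ.1], hρρ'.trans_lt hρ'.2⟩ H M hM hMH
  refine hcovers.blockCoupling hE hN hp hLM ?_
  refine (add_le_add (add_le_add ((hdens x hx ρ hρ _ _).1 le_rfl)
    ((hdens x hx ρ' hρ' _ _).2 (by linarith))) le_rfl).trans ?_
  rw [← ENNReal.ofReal_add (by positivity) (by positivity),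
    ← ENNReal.ofReal_add (by positivity) (by positivity),
    ← ENNReal.ofReal_add (by positivity) (by positivity)]
  exact ENNReal.ofReal_le_ofReal (add_block_errors_le hx₁ hxL hLx hj hν.le hC₀.le (by positivity)
    hκκ₁ hκκ₂ hκν (by omega) hH (hx₂ x hxx₂))

end Environment

/-! ### Comparison of the walks -/

namespace Environment

section Comparison

variable {E : Environment} {p₀ p₁ ρ ρ' d f : ℝ} {L N j n L₁ L₂ : ℕ} {D : ℤ}

theorem BlockCoupling.exists_isCoupling_walkLaw
    (h : E.BlockCoupling p₀ p₁ ρ ρ' L N D (ENNReal.ofReal d)) (hd : 0 ≤ d)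
    (hE : E.MarkovInvariant) (hS : E.Stationary) (hM : E.Monotonicity)
    (hρ : ρ ∈ E.J) (hρ' : ρ' ∈ E.J) (hle : ρ ≤ ρ') (hp : p₀ ≤ p₁) (hD : 0 ≤ D) (hL : 0 < L)
    (hn : 0 < n) (hj : j * L ≤ N) (hnj : n ≤ (j + 1) * L)
    (h₁₂ : L₁ = n ∧ L₂ = L ∨ L₁ = L ∧ L₂ = n) :
    ∃ Q, IsCoupling Q ((walkLaw E p₀ p₁ ρ L₁).map (upTo n))
        ((walkLaw E p₀ p₁ ρ' L₂).map (upTo n)) ∧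
      Q.real {w | ¬ ∀ s, w.1 s - j * D ≤ w.2 s} ≤ j * d := by
  have hn₁ : n ≤ (0 + 1) * n := by omega
  rcases h₁₂ with ⟨rfl, rfl⟩ | ⟨rfl, rfl⟩
  · rw [walkLaw_map_upTo p₀ p₁ ρ hn hn₁, walkLaw_map_upTo p₀ p₁ ρ' hL hnj]
    exact h.exists_isCoupling hd hM hρ hρ' hle hp hD (.annealed hE hS hρ L₂)
      (.resampled hE ρ' L₂) hj hnj
  · rw [walkLaw_map_upTo p₀ p₁ ρ hL hnj, walkLaw_map_upTo p₀ p₁ ρ' hn hn₁]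
    exact h.exists_isCoupling hd hM hρ hρ' hle hp hD (.resampled hE ρ L₁)
      (.annealed hE hS hρ' L₁) hj hnj

theorem BlockCoupling.exists_isCoupling_real_le
    (h : E.BlockCoupling p₀ p₁ ρ ρ' L N D (ENNReal.ofReal d)) (hd : 0 ≤ d)
    (hE : E.MarkovInvariant) (hS : E.Stationary) (hM : E.Monotonicity)
    (hρ : ρ ∈ E.J) (hρ' : ρ' ∈ E.J) (hle : ρ ≤ ρ') (hp : p₀ ≤ p₁) (hD : 0 ≤ D) (hDf : D < f)
    (hL : 0 < L) (hn : 0 < n) (hj : j * L ≤ N) (hnj : n ≤ (j + 1) * L)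
    (h₁₂ : L₁ = n ∧ L₂ = L ∨ L₁ = L ∧ L₂ = n) :
    ∃ Q, IsCoupling Q ((walkLaw E p₀ p₁ ρ L₁).map (upTo n))
        ((walkLaw E p₀ p₁ ρ' L₂).map (upTo n)) ∧
      Q.real {w | ∃ s, ((w.2 s - w.1 s : ℤ) : ℝ) < -(j * f)} ≤ j * d ∧
      (L < n → Q.real {w | ∃ s, ((w.2 s - w.1 s : ℤ) : ℝ) ≤ -(j * f)} ≤ j * d) := by
  obtain ⟨Q, hQ, hQd⟩ :=
    h.exists_isCoupling_walkLaw hd hE hS hM hρ hρ' hle hp hD hL hn hj hnj h₁₂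
  have : IsProbabilityMeasure (Q.map Prod.fst) :=
    hQ.1 ▸ Measure.isProbabilityMeasure_map (measurable_upTo n).aemeasurable
  have : IsProbabilityMeasure Q := Measure.isProbabilityMeasure_of_map Prod.fst
  refine ⟨Q, hQ, (measureReal_mono ?_).trans hQd, fun hLn => (measureReal_mono ?_).trans hQd⟩
  · rintro w ⟨s, hs⟩ hw
    have hws : (w.1 s : ℝ) - j * D ≤ w.2 s := by exact_mod_cast hw s
    have hjD : (j : ℝ) * D ≤ j * f := by gcongr
    push_cast at hs
    linarith
  · rintro w ⟨s, hs⟩ hw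
    have hws : (w.1 s : ℝ) - j * D ≤ w.2 s := by exact_mod_cast hw s
    have hj₀ : j ≠ 0 := by rintro rfl; omega
    have hjD : (j : ℝ) * D < j * f := by gcongr
    push_cast at hs
    linarith

theorem sub_mul_floor_div (n L : ℕ) : (n : ℝ) - L * ⌊(n : ℝ) / L⌋ = (n % L : ℕ) := by
  have hfloor : ⌊(n : ℝ) / L⌋ = (n / L : ℕ) := by
    rw [← Nat.floor_div_eq_div (K := ℝ), Int.natCast_floor_eq_floor (by positivity)]
  rw [hfloor, sub_eq_iff_eq_add, Int.cast_natCast]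
  exact_mod_cast (Nat.mod_add_div n L).symm

theorem BlockCoupling.speed_le_speed
    (h : E.BlockCoupling p₀ p₁ ρ ρ' L N D (ENNReal.ofReal d)) (hd : 0 ≤ d)
    (hE : E.MarkovInvariant) (hS : E.Stationary) (hM : E.Monotonicity)
    (hρ : ρ ∈ E.J) (hρ' : ρ' ∈ E.J) (hle : ρ ≤ ρ') (hp : p₀ ≤ p₁) (hD : 0 ≤ D) (hDf : D < f)
    (hL : 0 < L) (hn : 0 < n) (hj : j * L ≤ N) (hnj : n ≤ (j + 1) * L)
    (h₁₂ : L₁ = n ∧ L₂ = L ∨ L₁ = L ∧ L₂ = n) :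
    speed E p₀ p₁ ρ L₁ ≤ speed E p₀ p₁ ρ' L₂ + 2 * ((n - L * ⌊(n : ℝ) / L⌋) / n) +
      j * (f / n) + 2 * (j * d) := by
  have hD' : (0 : ℝ) ≤ D := by exact_mod_cast hD
  have hf : 0 ≤ f := by linarith
  rw [sub_mul_floor_div]
  rcases lt_or_ge n L with hnL | hLn
  · have hv := (abs_le.1 (abs_speed_le_one E p₀ p₁ ρ (L := L₁) (by omega))).2
    have hv' := (abs_le.1 (abs_speed_le_one E p₀ p₁ ρ' (L := L₂) (by omega))).1
    have hjf : 0 ≤ j * (f / n) := by positivity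
    have hjd : 0 ≤ j * d := by positivity
    rw [Nat.mod_eq_of_lt hnL, div_self (by positivity)]
    linarith
  · obtain ⟨k, hk⟩ := Nat.exists_eq_succ_of_ne_zero (Nat.div_pos hLn hL).ne'
    have hnk : n = (k + 1) * L + n % L := by
      rw [← Nat.succ_eq_add_one, ← hk, mul_comm, Nat.div_add_mod]
    have hkj : k ≤ j :=
      Nat.le_of_succ_le_succ
        (Nat.le_of_mul_le_mul_right ((hnk ▸ Nat.le_add_right _ _).trans hnj) hL)
    have hkN : k * L ≤ N := (Nat.mul_le_mul_right L hkj).trans hj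
    have hkD : k * (D / n) ≤ j * (f / n) := by gcongr
    have hkd : k * d ≤ j * d := by gcongr
    rcases h₁₂ with ⟨rfl, rfl⟩ | ⟨rfl, rfl⟩
    · linarith [h.speed_le hd hE hS hM hρ hρ' hle hp hD hL hkN hnk]
    · linarith [h.le_speed hd hE hS hM hρ hρ' hle hp hD hL hkN hnk]

end Comparison

end Environment

theorem exists_scale {x₀ f : ℝ} (hx₀ : 1 ≤ x₀) {L : ℕ} (hL : x₀ ≤ Real.log L)
    (hf : Real.log L ^ 90 ≤ f) (hfL : f ≤ (L : ℝ) ^ (1 / 10 : ℝ)) :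
    ∃ x ≥ x₀, f = x ^ 40 ∧ f ^ (1 / 40 : ℝ) = x ∧ f ^ (-(1 / 40) : ℝ) = x⁻¹ ∧
      x ^ 400 ≤ L ∧ Real.log L ≤ x := by
  have hlog : 1 ≤ Real.log L := hx₀.trans hL
  have hf₁ : 1 ≤ f := (one_le_pow₀ hlog).trans hf
  have hx_pow : (f ^ (1 / 40 : ℝ)) ^ 40 = f := by
    rw [← Real.rpow_natCast, ← Real.rpow_mul (by linarith)]
    norm_num
  have hx₁ : 1 ≤ f ^ (1 / 40 : ℝ) := Real.one_le_rpow hf₁ (by norm_num)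
  have hlog_le : Real.log L ≤ f ^ (1 / 40 : ℝ) := by
    refine le_of_pow_le_pow_left₀ (n := 90) (by norm_num) (by linarith) (hf.trans ?_)
    calc f = (f ^ (1 / 40 : ℝ)) ^ 40 := hx_pow.symm
      _ ≤ _ := pow_le_pow_right₀ hx₁ (by norm_num)
  refine ⟨f ^ (1 / 40 : ℝ), hL.trans hlog_le, hx_pow.symm, rfl, Real.rpow_neg (by linarith) _, ?_,
    hlog_le⟩
  calc (f ^ (1 / 40 : ℝ)) ^ 400 = ((f ^ (1 / 40 : ℝ)) ^ 40) ^ 10 := by rw [← pow_mul]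
    _ = f ^ 10 := by rw [hx_pow]
    _ ≤ ((L : ℝ) ^ (1 / 10 : ℝ)) ^ 10 := by gcongr
    _ = L := by
      rw [← Real.rpow_natCast, ← Real.rpow_mul (by positivity)]
      norm_num

theorem Environment.exists_blockCoupling_of_log_pow_le {E : Environment} {ν : ℝ} (hν : 0 < ν)
    (hE : E.MarkovInvariant) (hD : E.DensityAtStationarity) (hN : E.NoDriftIn ν)
    (hC : E.Covering ν) :
    ∃ L₀ : ℕ, 1 ≤ L₀ ∧ ∀ L : ℕ, L₀ < L →
      ∀ f : ℝ, Real.log L ^ 90 ≤ f → f ≤ (L : ℝ) ^ (1 / 10 : ℝ) →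
      ∀ ρ ∈ E.J, ∀ ρ' ∈ E.J, ρ + f ^ (-(1 / 40) : ℝ) ≤ ρ' → ∀ j : ℕ, 1 ≤ j →
      ∀ p₀ p₁ : ℝ, p₀ ≤ p₁ → ∃ D : ℤ, 0 ≤ D ∧ D < f ∧
        E.BlockCoupling p₀ p₁ ρ ρ' L (j * L) D
          (ENNReal.ofReal (j * Real.exp (-f ^ (1 / 40 : ℝ)))) := by
  obtain ⟨x₀, hblock⟩ := E.exists_blockCoupling hν hE hD hN hC
  refine ⟨⌈Real.exp (max 1 x₀)⌉₊, Nat.one_le_ceil_iff.2 (Real.exp_pos _),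
    fun L hL f hf hfL ρ hρ ρ' hρ' hρρ' j hj p₀ p₁ hp => ?_⟩
  have hexp : Real.exp (max 1 x₀) ≤ L := (Nat.le_ceil _).trans (by exact_mod_cast hL.le)
  have hlog : max 1 x₀ ≤ Real.log L :=
    (Real.le_log_iff_exp_le ((Real.exp_pos _).trans_le hexp)).2 hexp
  obtain ⟨x, hx, rfl, hfx, hfx', hxL, hLx⟩ := exists_scale (le_max_left 1 x₀) hlog hf hfL
  rw [hfx'] at hρρ'
  rw [hfx]
  obtain ⟨hx₁, hxx₀⟩ := max_le_iff.1 hx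
  refine ⟨2 * coverTime x, by positivity, ?_,
    hblock x hxx₀ L hxL hLx ρ hρ ρ' hρ' hρρ' j hj p₀ p₁ hp⟩
  push_cast
  linarith [coverTime_le x, pow_pos (by linarith : 0 < x) 40]

theorem exists_ceil_div_eq {n L : ℕ} (hn : 0 < n) (hL : 0 < L) :
    ∃ j : ℕ, ⌈(n : ℝ) / L⌉ = j + 1 ∧ n ≤ (j + 1) * L := by
  obtain ⟨j, hj⟩ := Nat.exists_eq_succ_of_ne_zero
    (Nat.ceil_pos.2 (by positivity : (0 : ℝ) < n / L)).ne'
  refine ⟨j, ?_, ?_⟩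
  · rw [← Int.natCast_ceil_eq_ceil (by positivity), hj, Nat.cast_succ]
  · have hceil := Nat.le_ceil ((n : ℝ) / L)
    rw [hj, div_le_iff₀ (by positivity)] at hceil
    exact_mod_cast hceil

theorem proposition3p1_general (E : Environment) (ν : ℝ) (hν : 0 < ν)
    (hP1 : E.MarkovInvariant) (hP2 : E.Stationary) (hP3 : E.Monotonicity)
    (hP4 : E.DensityAtStationarity) (hC21 : E.NoDriftIn ν) (hC22 : E.Covering ν) :
    ∃ L₀ : ℕ, 1 ≤ L₀ ∧ ∀ p₀ p₁ : ℝ, p₀ ≤ p₁ → ∀ L : ℕ, L₀ < L →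
      ∀ f : ℝ, Real.log L ^ 90 ≤ f → f ≤ (L : ℝ) ^ (1 / 10 : ℝ) → ∀ n : ℕ, 1 ≤ n →
      ∀ ρ ∈ E.J, ∀ ε : ℝ, f ^ (-(1 / 40) : ℝ) ≤ ε → ρ + ε ∈ E.J →
      ∀ L₁ L₂ : ℕ, L₁ = n ∧ L₂ = L ∨ L₁ = L ∧ L₂ = n →
        (∃ Q : Measure ((Fin (n + 1) → ℤ) × (Fin (n + 1) → ℤ)),
            IsCoupling Q ((walkLaw E p₀ p₁ ρ L₁).map (upTo n))
              ((walkLaw E p₀ p₁ (ρ + ε) L₂).map (upTo n)) ∧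
            Q.real {w | ∃ s, ((w.2 s - w.1 s : ℤ) : ℝ) < -(⌈(n : ℝ) / L - 1⌉ * f)} ≤
              (⌈(n : ℝ) / L⌉ - 1) ^ 2 * Real.exp (-f ^ (1 / 40 : ℝ)) ∧
            (L < n →
              Q.real {w | ∃ s, ((w.2 s - w.1 s : ℤ) : ℝ) ≤ -(⌈(n : ℝ) / L - 1⌉ * f)} ≤
                (⌈(n : ℝ) / L⌉ - 1) ^ 2 * Real.exp (-f ^ (1 / 40 : ℝ)))) ∧
          speed E p₀ p₁ ρ L₁ ≤ speed E p₀ p₁ (ρ + ε) L₂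
            + 2 * ((n - L * ⌊(n : ℝ) / L⌋) / n) + ⌈(n : ℝ) / L - 1⌉ * (f / n)
            + 2 * (⌈(n : ℝ) / L⌉ - 1) ^ 2 * Real.exp (-f ^ (1 / 40 : ℝ)) := by
  obtain ⟨L₀, hL₀, hblock⟩ := E.exists_blockCoupling_of_log_pow_le hν hP1 hP4 hC21 hC22
  refine ⟨L₀, hL₀, fun p₀ p₁ hp L hL f hf hfL n hn ρ hρ ε hε hρε L₁ L₂ h₁₂ => ?_⟩
  have hL_pos : 0 < L := by omega
  have hf_nonneg : 0 ≤ f := (by positivity : 0 ≤ Real.log L ^ 90).trans hf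
  have hle : ρ ≤ ρ + ε := le_add_of_nonneg_right ((Real.rpow_nonneg hf_nonneg _).trans hε)
  obtain ⟨j, hceil, hnj⟩ := exists_ceil_div_eq hn hL_pos
  obtain ⟨D, hD, hDf, hcoupling⟩ := hblock L hL f hf hfL ρ hρ (ρ + ε) hρε (by gcongr) (max j 1)
    (le_max_right j 1) p₀ p₁ hp
  have hjL : j * L ≤ max j 1 * L := Nat.mul_le_mul_right L (le_max_left j 1)
  have herr (e : ℝ) : (j : ℝ) ^ 2 * e = j * ((max j 1 : ℕ) * e) := by
    rcases j.eq_zero_or_pos with rfl | hj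
    · simp
    · rw [max_eq_left (Nat.succ_le_of_lt hj), sq, mul_assoc]
  rw [Int.ceil_sub_one, hceil]
  simp only [add_sub_cancel_right, Int.cast_add, Int.cast_natCast, Int.cast_one, mul_assoc, herr]
  exact ⟨hcoupling.exists_isCoupling_real_le (by positivity) hP1 hP2 hP3 hρ hρε hle hp hD hDf
      hL_pos hn hjL hnj h₁₂,
    hcoupling.speed_le_speed (by positivity) hP1 hP2 hP3 hρ hρε hle hp hD hDf hL_pos hn hjL hnj
      h₁₂⟩

end

theorem proposition3p1 (E : Environment) (ν : ℝ) (hν : 0 < ν)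
    (hP1 : E.MarkovInvariant) (hP2 : E.Stationary) (hP3 : E.Monotonicity)
    (hP4 : E.DensityAtStationarity) (hC21 : E.NoDriftIn ν) (hC22 : E.Covering ν) :
    ∃ L₀ : ℕ, 1 ≤ L₀ ∧
      ∀ p₀ p₁ : ℝ, 0 ≤ p₀ → p₀ < p₁ → p₁ ≤ 1 →
      ∀ L : ℕ, L₀ < L →
      ∀ f : ℝ, Real.log L ^ 90 ≤ f → f ≤ (L : ℝ) ^ (1 / 10 : ℝ) →
      ∀ n : ℕ, 1 ≤ n →
      ∀ ρ ∈ E.J, f ^ (-(1 / 40) : ℝ) < ρ →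
      ∀ ε : ℝ, f ^ (-(1 / 40) : ℝ) ≤ ε → ρ + ε ∈ E.J →
        -- first walk refreshed every `n` steps, second walk refreshed every `L` steps
        ((∃ Q : Measure ((Fin (n + 1) → ℤ) × (Fin (n + 1) → ℤ)),
            IsCoupling Q ((walkLaw E p₀ p₁ ρ n).map (upTo n))
              ((walkLaw E p₀ p₁ (ρ + ε) L).map (upTo n)) ∧
            Q.real {w | ∃ s, ((w.2 s - w.1 s : ℤ) : ℝ) < -(⌈(n : ℝ) / L - 1⌉ * f)} ≤
              (⌈(n : ℝ) / L⌉ - 1) ^ 2 * Real.exp (-f ^ (1 / 40 : ℝ)) ∧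
            (L < n →
              Q.real {w | ∃ s, ((w.2 s - w.1 s : ℤ) : ℝ) ≤ -(⌈(n : ℝ) / L - 1⌉ * f)} ≤
                (⌈(n : ℝ) / L⌉ - 1) ^ 2 * Real.exp (-f ^ (1 / 40 : ℝ)))) ∧
          speed E p₀ p₁ ρ n ≤ speed E p₀ p₁ (ρ + ε) L
            + 2 * ((n - L * ⌊(n : ℝ) / L⌋) / n) + ⌈(n : ℝ) / L - 1⌉ * (f / n)
            + 2 * (⌈(n : ℝ) / L⌉ - 1) ^ 2 * Real.exp (-f ^ (1 / 40 : ℝ))) ∧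
        -- first walk refreshed every `L` steps, second walk refreshed every `n` steps
        ((∃ Q : Measure ((Fin (n + 1) → ℤ) × (Fin (n + 1) → ℤ)),
            IsCoupling Q ((walkLaw E p₀ p₁ ρ L).map (upTo n))
              ((walkLaw E p₀ p₁ (ρ + ε) n).map (upTo n)) ∧
            Q.real {w | ∃ s, ((w.2 s - w.1 s : ℤ) : ℝ) < -(⌈(n : ℝ) / L - 1⌉ * f)} ≤
              (⌈(n : ℝ) / L⌉ - 1) ^ 2 * Real.exp (-f ^ (1 / 40 : ℝ)) ∧
            (L < n →
              Q.real {w | ∃ s, ((w.2 s - w.1 s : ℤ) : ℝ) ≤ -(⌈(n : ℝ) / L - 1⌉ * f)} ≤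
                (⌈(n : ℝ) / L⌉ - 1) ^ 2 * Real.exp (-f ^ (1 / 40 : ℝ)))) ∧
          speed E p₀ p₁ ρ L ≤ speed E p₀ p₁ (ρ + ε) n
            + 2 * ((n - L * ⌊(n : ℝ) / L⌋) / n) + ⌈(n : ℝ) / L - 1⌉ * (f / n)
            + 2 * (⌈(n : ℝ) / L⌉ - 1) ^ 2 * Real.exp (-f ^ (1 / 40 : ℝ))) := by
  obtain ⟨L₀, hL₀, h⟩ := proposition3p1_general E ν hν hP1 hP2 hP3 hP4 hC21 hC22
  exact ⟨L₀, hL₀, fun p₀ p₁ _ hp _ L hL f hf hfL n hn ρ hρ _ ε hε hρε =>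
    have hpair := h p₀ p₁ hp.le L hL f hf hfL n hn ρ hρ ε hε hρε
    ⟨hpair n L (.inl ⟨rfl, rfl⟩), hpair L n (.inr ⟨rfl, rfl⟩)⟩⟩
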